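/- Let $\mathcal{L}_A$ be the first-order language (with equality) of signature $\langle 0,1,+,\times,<\rangle$, and let $\mathrm{EA}=\mathrm{I}\Delta_0+\exp$ be elementary arithmetic: the axioms $\mathrm{PA}^-$ of nonnegative parts of discretely ordered rings, the induction scheme (with parameters) for $\Delta_0$ formulae of $\mathcal{L}_A$, and the axiom $\forall x\,\forall y\,\exists z\; x^y=z$ (the graph of exponentiation being represented by an arithmetical formula). Fix a standard Gödel numbering $\varphi\mapsto\ulcorner\varphi\urcorner$ of the formulae of the languages obtained from $\mathcal{L}_A$ by adding finitely many relation symbols, where the new symbols come from a fixed supply of countably many symbols of each arity; $\overline{n}$ denotes the numeral of $n$. A sentence $\alpha$ in such a language is a (finitely axiomatized) definition of truth for $\mathcal{L}_A$ over $\mathrm{EA}$ if $\alpha$ is consistent, $\alpha$ proves every axiom of $\mathrm{EA}$, and there is a formula $\Theta(x)$ with one free variable such that for every $\mathcal{L}_A$-sentence $\sigma$, $$\alpha\vdash \Theta\bigl(\overline{\ulcorner\sigma\urcorner}\bigr)\leftrightarrow\sigma .$$ Let $\mathrm{DEF}\subseteq\mathbb{N}$ be the set of Gödel codes of definitions of truth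 for $\mathcal{L}_A$. **Theorem.** $\mathrm{DEF}$ is not $\Sigma_2$-definable in the standard model of arithmetic: there is no $\Sigma_2$ formula $\varphi(x)$ of $\mathcal{L}_A$ such that for all $m\in\mathbb{N}$, $\mathbb{N}\models\varphi(\overline{m})$ if and only if $m\in\mathrm{DEF}$. -/

import Mathlib

open FirstOrder FirstOrder.Language

namespace TruthDef

/-! ## The language of arithmetic -/

/-- Function symbols of the language of arithmetic. -/
inductive ArithFunc : ℕ → Type
  | zero : ArithFunc 0
  | one : ArithFunc 0
  | add : ArithFunc 2
  | mul : ArithFunc 2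

/-- Relation symbols of the language of arithmetic. -/
inductive ArithRel : ℕ → Type
  | lt : ArithRel 2

/-- The first-order language (with equality) of arithmetic, of signature `0, 1, +, ×, <`. -/
def arith : Language where
  Functions := ArithFunc
  Relations := ArithRel

/-- Additional relation symbols: countably many `P k 0, P k 1, …` of every arity `k`. -/
def preds : Language where
  Functions := fun _ => Empty
  Relations := fun _ => ℕ

/-- The language of arithmetic together with a supply of fresh relation symbols. Every sentence
uses finitely many of them, so that its sentences are exactly the sentences of the languages
obtained from the language of arithmetic by adding finitely many relation symbols. -/
abbrev arithPreds : Language := arith.sum preds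

/-- The inclusion of the language of arithmetic into the extended language. -/
abbrev incl : arith →ᴸ arithPreds := LHom.sumInl

section Terms

variable {α : Type}

instance : Zero (arith.Term α) where
  zero := Term.func ArithFunc.zero ![]

instance : One (arith.Term α) where
  one := Term.func ArithFunc.one ![]

instance : Add (arith.Term α) where
  add t s := Term.func ArithFunc.add ![t, s]

instance : Mul (arith.Term α) where
  mul t s := Term.func ArithFunc.mul ![t, s]

/-- The numeral `0 + 1 + ⋯ + 1` with `n` summands `1`. -/
def numeral : ℕ → arith.Term α
  | 0 => 0
  | n + 1 => numeral n + 1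

/-- A term, seen in the scope of one more bound variable (in which it does not occur). -/
def lift {n : ℕ} (t : arith.Term (α ⊕ Fin n)) : arith.Term (α ⊕ Fin (n + 1)) :=
  t.relabel (Sum.map id Fin.castSucc)

/-- The `i`-th bound variable. -/
def bv {n : ℕ} (i : Fin n) : arith.Term (α ⊕ Fin n) := Term.var (Sum.inr i)

/-- The atomic formula `t < s`. -/
def ltF {n : ℕ} (t s : arith.Term (α ⊕ Fin n)) : arith.BoundedFormula α n :=
  BoundedFormula.rel ArithRel.lt ![t, s]

/-- The bounded quantifier `∀ x < t, φ`, where `x` is the last bound variable. -/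
def ballF {n : ℕ} (t : arith.Term (α ⊕ Fin n)) (φ : arith.BoundedFormula α (n + 1)) :
    arith.BoundedFormula α n :=
  ∀' (ltF (bv (Fin.last n)) (lift t) ⟹ φ)

/-- The bounded quantifier `∃ x < t, φ`, where `x` is the last bound variable. -/
def bexF {n : ℕ} (t : arith.Term (α ⊕ Fin n)) (φ : arith.BoundedFormula α (n + 1)) :
    arith.BoundedFormula α n :=
  ∃' (ltF (bv (Fin.last n)) (lift t) ⊓ φ)

end Terms

/-- The standard model of arithmetic. -/
instance : arith.Structure ℕ where
  funMap
    | ArithFunc.zero, _ => 0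
    | ArithFunc.one, _ => 1
    | ArithFunc.add, v => v 0 + v 1
    | ArithFunc.mul, v => v 0 * v 1
  RelMap
    | ArithRel.lt, v => v 0 < v 1

/-! ## The arithmetical hierarchy -/

/-- `Δ₀` formulae: the least class that contains the quantifier-free formulae and is closed under
propositional connectives (all of which are built from `⊥` and `⟹`) and bounded quantifiers. -/
inductive IsDelta0 {α : Type} : ∀ {n : ℕ}, arith.BoundedFormula α n → Prop
  | of_isQF {n : ℕ} {φ : arith.BoundedFormula α n} : φ.IsQF → IsDelta0 φ
  | imp {n : ℕ} {φ ψ : arith.BoundedFormula α n} : IsDelta0 φ → IsDelta0 ψ → IsDelta0 (φ ⟹ ψ)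
  | ball {n : ℕ} (t : arith.Term (α ⊕ Fin n)) {φ : arith.BoundedFormula α (n + 1)} :
      IsDelta0 φ → IsDelta0 (ballF t φ)
  | bex {n : ℕ} (t : arith.Term (α ⊕ Fin n)) {φ : arith.BoundedFormula α (n + 1)} :
      IsDelta0 φ → IsDelta0 (bexF t φ)

mutual

/-- `Σ₀ = Δ₀`, and `Σₖ₊₁` is the least class that contains `Πₖ` and is closed under adding
existential quantifiers. -/
inductive IsSigma {α : Type} : ℕ → ∀ {n : ℕ}, arith.BoundedFormula α n → Prop
  | zero {n : ℕ} {φ : arith.BoundedFormula α n} : IsDelta0 φ → IsSigma 0 φ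
  | of_pi {k n : ℕ} {φ : arith.BoundedFormula α n} : IsPi k φ → IsSigma (k + 1) φ
  | ex {k n : ℕ} {φ : arith.BoundedFormula α (n + 1)} :
      IsSigma (k + 1) φ → IsSigma (k + 1) (∃' φ)

/-- `Π₀ = Δ₀`, and `Πₖ₊₁` is the least class that contains `Σₖ` and is closed under adding
universal quantifiers. -/
inductive IsPi {α : Type} : ℕ → ∀ {n : ℕ}, arith.BoundedFormula α n → Prop
  | zero {n : ℕ} {φ : arith.BoundedFormula α n} : IsDelta0 φ → IsPi 0 φ
  | of_sigma {k n : ℕ} {φ : arith.BoundedFormula α n} : IsSigma k φ → IsPi (k + 1) φ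
  | all {k n : ℕ} {φ : arith.BoundedFormula α (n + 1)} :
      IsPi (k + 1) φ → IsPi (k + 1) (∀' φ)

end

/-- The set `A` of natural numbers is defined in the standard model by a `Σₖ` formula with one free
variable. -/
def SigmaDefinable (k : ℕ) (A : Set ℕ) : Prop :=
  ∃ φ : arith.Formula (Fin 1), IsSigma k φ ∧ ∀ m : ℕ, φ.Realize (fun _ => m) ↔ m ∈ A

/-! ## Elementary arithmetic -/

/-- The axioms of `PA⁻`, the theory of the nonnegative parts of discretely ordered rings. -/
inductive PAminus : arith.Sentence → Prop
  | add_assoc : PAminus (∀' ∀' ∀' (((bv 0 + bv 1) + bv 2) =' (bv 0 + (bv 1 + bv 2))))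
  | add_comm : PAminus (∀' ∀' ((bv 0 + bv 1) =' (bv 1 + bv 0)))
  | mul_assoc : PAminus (∀' ∀' ∀' (((bv 0 * bv 1) * bv 2) =' (bv 0 * (bv 1 * bv 2))))
  | mul_comm : PAminus (∀' ∀' ((bv 0 * bv 1) =' (bv 1 * bv 0)))
  | mul_add : PAminus (∀' ∀' ∀' ((bv 0 * (bv 1 + bv 2)) =' (bv 0 * bv 1 + bv 0 * bv 2)))
  | add_zero : PAminus (∀' ((bv 0 + 0) =' bv 0))
  | mul_zero : PAminus (∀' ((bv 0 * 0) =' 0))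
  | mul_one : PAminus (∀' ((bv 0 * 1) =' bv 0))
  | lt_trans : PAminus (∀' ∀' ∀' ((ltF (bv 0) (bv 1) ⊓ ltF (bv 1) (bv 2)) ⟹ ltF (bv 0) (bv 2)))
  | lt_irrefl : PAminus (∀' ∼(ltF (bv 0) (bv 0)))
  | lt_total : PAminus (∀' ∀' (ltF (bv 0) (bv 1) ⊔ (bv 0 =' bv 1) ⊔ ltF (bv 1) (bv 0)))
  | add_lt : PAminus (∀' ∀' ∀' (ltF (bv 0) (bv 1) ⟹ ltF (bv 0 + bv 2) (bv 1 + bv 2)))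
  | mul_lt : PAminus (∀' ∀' ∀'
      ((ltF 0 (bv 2) ⊓ ltF (bv 0) (bv 1)) ⟹ ltF (bv 0 * bv 2) (bv 1 * bv 2)))
  | lt_sub : PAminus (∀' ∀' (ltF (bv 0) (bv 1) ⟹ ∃' ((bv 0 + bv 2) =' bv 1)))
  | zero_lt_one : PAminus (ltF 0 1)
  | one_le : PAminus (∀' (ltF 0 (bv 0) ⟹ (ltF 1 (bv 0) ⊔ (1 =' bv 0))))
  | zero_le : PAminus (∀' (ltF 0 (bv 0) ⊔ (0 =' bv 0)))

/-- The induction axiom for `φ(p₀, …, pₙ₋₁, x)`: the universal closure, with respect to the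
parameters `p`, of `φ(p, 0) ∧ ∀ x (φ(p, x) → φ(p, x + 1)) → ∀ x φ(p, x)`. -/
def inductionAxiom {n : ℕ} (φ : arith.Formula (Fin (n + 1))) : arith.Sentence :=
  let base : arith.Formula (Fin n) := φ.subst (Fin.lastCases 0 fun i => Term.var i)
  let succ : arith.Formula (Fin (n + 1)) :=
    φ.subst (Fin.lastCases (Term.var (Fin.last n) + 1) fun i => Term.var i.castSucc)
  let base' : arith.BoundedFormula Empty n := BoundedFormula.relabel (k := 0) Sum.inr base
  let φ' : arith.BoundedFormula Empty (n + 1) := BoundedFormula.relabel (k := 0) Sum.inr φ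
  let succ' : arith.BoundedFormula Empty (n + 1) :=
    BoundedFormula.relabel (k := 0) Sum.inr succ
  ((base' ⊓ ∀' (φ' ⟹ succ')) ⟹ ∀' φ').alls

/-- Gödel's `β` relation `β(a, b, i) = r`: `r` is the remainder of `a` modulo `1 + (i + 1) b`. -/
def betaF {n : ℕ} (a b i r : arith.Term (Empty ⊕ Fin n)) : arith.BoundedFormula Empty n :=
  ltF r (1 + (i + 1) * b) ⊓
    ∃' (lift a =' (bv (Fin.last n) * (1 + (lift i + 1) * lift b) + lift r))

/-- The representation `exp(x, y) = z` of the relation `x ^ y = z`: for some `a`, `b`, the numbers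
`uᵢ = β(a, b, i)`, `i ≤ y`, satisfy `u₀ = 1`, `uᵢ₊₁ = uᵢ * x` for `i < y`, and `u_y = z`.
Here `x, y, z` are the bound variables `0, 1, 2`. -/
def expF : arith.BoundedFormula Empty 3 :=
  ∃' ∃' (betaF (bv 3) (bv 4) 0 1 ⊓ betaF (bv 3) (bv 4) (bv 1) (bv 2) ⊓
    ballF (bv 1)
      (∃' (betaF (bv 3) (bv 4) (bv 5) (bv 6) ⊓ betaF (bv 3) (bv 4) (bv 5 + 1) (bv 6 * bv 0))))

/-- Elementary arithmetic `EA = IΔ₀ + exp`: the axioms of `PA⁻`, induction (with parameters) for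
`Δ₀` formulae, and the axiom `∀ x ∀ y ∃ z, exp(x, y) = z`. -/
def EA : arith.Theory :=
  {ψ | PAminus ψ} ∪
  {ψ | ∃ (n : ℕ) (φ : arith.Formula (Fin (n + 1))), IsDelta0 φ ∧ ψ = inductionAxiom φ} ∪
  {∀' ∀' ∃' expF}

/-! ## Gödel codes -/

/-- The code of a finite sequence of numbers. -/
def codeVec {k : ℕ} (v : Fin k → ℕ) : ℕ := Encodable.encode (List.ofFn v)

/-- The code of a function symbol. -/
def codeFunc : ∀ {k : ℕ}, arithPreds.Functions k → ℕ
  | _, Sum.inl ArithFunc.zero => 0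
  | _, Sum.inl ArithFunc.one => 1
  | _, Sum.inl ArithFunc.add => 2
  | _, Sum.inl ArithFunc.mul => 3

/-- The code of a relation symbol; `<` gets the code `0`. -/
def codeRel : ∀ {k : ℕ}, arithPreds.Relations k → ℕ
  | _, Sum.inl ArithRel.lt => 0
  | k, Sum.inr i => Nat.pair k i + 1

/-- The code of a term. -/
def codeTerm {n : ℕ} : arithPreds.Term (Empty ⊕ Fin n) → ℕ
  | Term.var (Sum.inr i) => Nat.pair 0 i
  | Term.func f ts => Nat.pair 1 (Nat.pair (codeFunc f) (codeVec fun i => codeTerm (ts i)))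

/-- The code of a formula. -/
def code : ∀ {n : ℕ}, arithPreds.BoundedFormula Empty n → ℕ
  | _, BoundedFormula.falsum => Nat.pair 0 0
  | _, BoundedFormula.equal t s => Nat.pair 1 (Nat.pair (codeTerm t) (codeTerm s))
  | _, BoundedFormula.rel R ts =>
      Nat.pair 2 (Nat.pair (codeRel R) (codeVec fun i => codeTerm (ts i)))
  | _, BoundedFormula.imp φ ψ => Nat.pair 3 (Nat.pair (code φ) (code ψ))
  | _, BoundedFormula.all φ => Nat.pair 4 (code φ)

/-! ## Definitions of truth -/

/-- The sentence `Θ(⌜σ⌝) ↔ σ`, for an arithmetical sentence `σ`. -/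
def tarskiBiconditional (Θ : arithPreds.Formula (Fin 1)) (σ : arith.Sentence) :
    arithPreds.Sentence :=
  Θ.subst (fun _ => incl.onTerm (numeral (code (incl.onSentence σ)))) ⇔ incl.onSentence σ

/-- The sentence `α` is a (finitely axiomatized) definition of truth for the language of arithmetic:
it is consistent, it proves `EA`, and for some formula `Θ` with one free variable it proves
`Θ(⌜σ⌝) ↔ σ` for every arithmetical sentence `σ`. -/
def IsTruthDefinition (α : arithPreds.Sentence) : Prop :=
  Theory.IsSatisfiable {α} ∧
  (∀ ψ ∈ EA, ({α} : arithPreds.Theory) ⊨ᵇ incl.onSentence ψ) ∧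
  ∃ Θ : arithPreds.Formula (Fin 1), ∀ σ : arith.Sentence,
    ({α} : arithPreds.Theory) ⊨ᵇ tarskiBiconditional Θ σ

/-- The set of codes of definitions of truth. -/
def DEF : Set ℕ := {m | ∃ α : arithPreds.Sentence, IsTruthDefinition α ∧ code α = m}

end TruthDef

-- The proof is by diagonalization. Suppose a `Σ₂` formula `φ(x)` defines `DEF`. Bounding its outer
-- existential quantifiers by a new variable `c` gives `G(c, x)` (`IsSigma.exists_bounded`): in `ℕ`,
-- `φ(x)` holds iff `G(c, x)` holds for some `c`, and `G` is monotone in `c`. Moreover, if `G` holds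
-- at standard arguments in an end-extension of `ℕ`, then it holds in `ℕ`: bounded witnesses are
-- standard, and `Π₁` truth is inherited by the initial segment.
--
-- Let `α` be a sentence that refers to its own code and axiomatizes `PA⁻`, totality of
-- exponentiation, induction for the relations given by a satisfaction predicate, and Tarski's
-- clauses only at those codes `c` for which `¬ G(c, ⌜α⌝)` (`Spec`, `exists_spec_sentence`).
--
-- If `⌜α⌝ ∈ DEF`, then `G(k, ⌜α⌝)` holds for some `k`, hence at all `c ≥ k`, so the guard fails
-- from `k` on. Then `ℕ` with satisfaction restricted to codes below `k` is a model of `α`. All its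
-- relations are arithmetical, so a truth formula for `α` would make arithmetical truth
-- arithmetical, against Tarski (`not_isTruthDefinition_of_stdModel`, `not_arithmetical_truth`).
--
-- If `⌜α⌝ ∉ DEF`, then `¬ G(c, ⌜α⌝)` is true in `ℕ` for every `c`, hence true at every standard `c`
-- in every model of `α`. All Tarski clauses for standard codes are then available, so `α` proves
-- the biconditionals and every instance of arithmetical induction. It is consistent, being true in
-- `ℕ` with the full satisfaction relation. So `α` is a definition of truth
-- (`isTruthDefinition_of_spec`), a contradiction.
--
-- Weak theories never have to formalize syntax here: assignments, codes of numerals, term values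
-- and satisfaction are new relation symbols governed by axioms, and only their behaviour at
-- standard codes matters. The axioms are not written out as formulas either; `UDef` shows that one
-- formula expresses them in all structures.

namespace TruthDef

/-! ## Uniformly definable relations -/

section UniformDefinability

variable {L : FirstOrder.Language.{0, 0}} {I : Type*} {M : I → Type} [∀ i, L.Structure (M i)]
  {ι κ : Type}

/-- A family of relations on a family of structures is uniformly definable if one formula defines
all of its members. -/
def UDef (L : FirstOrder.Language.{0, 0}) {I : Type*} (M : I → Type) [∀ i, L.Structure (M i)]
    {ι : Type}
    (S : ∀ i, (ι → M i) → Prop) : Prop :=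
  ∃ φ : L.Formula ι, ∀ i v, φ.Realize v ↔ S i v

/-- A family of functions is uniformly definable if the family of the graphs is. -/
structure UFun (L : FirstOrder.Language.{0, 0}) {I : Type*} (M : I → Type) [∀ i, L.Structure (M i)]
    {ι : Type} (f : ∀ i, (ι → M i) → M i) : Prop where
  graph : UDef L M (ι := Option ι) fun i w => w none = f i fun j => w (some j)

namespace UDef

variable {S T : ∀ i, (ι → M i) → Prop}

theorem congr (h : UDef L M S) (e : ∀ i v, S i v ↔ T i v) : UDef L M T := by
  obtain ⟨φ, hφ⟩ := h
  exact ⟨φ, fun i v => (hφ i v).trans (e i v)⟩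

theorem false : UDef L M fun i (_ : ι → M i) => False :=
  ⟨⊥, fun _ _ => by simp⟩

theorem and (hS : UDef L M S) (hT : UDef L M T) : UDef L M fun i v => S i v ∧ T i v := by
  obtain ⟨φ, hφ⟩ := hS
  obtain ⟨ψ, hψ⟩ := hT
  exact ⟨φ ⊓ ψ, fun i v => by simp [hφ, hψ]⟩

theorem or (hS : UDef L M S) (hT : UDef L M T) : UDef L M fun i v => S i v ∨ T i v := by
  obtain ⟨φ, hφ⟩ := hS
  obtain ⟨ψ, hψ⟩ := hT
  exact ⟨φ ⊔ ψ, fun i v => by simp [hφ, hψ]⟩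

theorem imp (hS : UDef L M S) (hT : UDef L M T) : UDef L M fun i v => S i v → T i v := by
  obtain ⟨φ, hφ⟩ := hS
  obtain ⟨ψ, hψ⟩ := hT
  exact ⟨φ.imp ψ, fun i v => by simp [hφ, hψ]⟩

theorem iff (hS : UDef L M S) (hT : UDef L M T) : UDef L M fun i v => S i v ↔ T i v := by
  obtain ⟨φ, hφ⟩ := hS
  obtain ⟨ψ, hψ⟩ := hT
  exact ⟨φ.iff ψ, fun i v => by simp [hφ, hψ]⟩

theorem not (hS : UDef L M S) : UDef L M fun i v => ¬ S i v := by
  obtain ⟨φ, hφ⟩ := hS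
  exact ⟨φ.not, fun i v => by simp [hφ]⟩

theorem reindex {S : ∀ i, (κ → M i) → Prop} (hS : UDef L M S) (g : κ → ι) :
    UDef L M fun i (v : ι → M i) => S i (fun k => v (g k)) := by
  obtain ⟨φ, hφ⟩ := hS
  exact ⟨φ.relabel g, fun i v => by simp [hφ, Function.comp_def]⟩

theorem ex_family [Finite κ] {S : ∀ i, (ι → M i) → (κ → M i) → Prop}
    (h : UDef L M (ι := ι ⊕ κ) fun i w => S i (fun j => w (.inl j)) (fun k => w (.inr k))) :
    UDef L M fun i v => ∃ u, S i v u := by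
  obtain ⟨φ, hφ⟩ := h
  exact ⟨φ.iExs κ, fun i v => by simp [hφ]⟩

theorem ex {S : ∀ i, (ι → M i) → M i → Prop}
    (h : UDef L M (ι := Option ι) fun i w => S i (fun j => w (some j)) (w none)) :
    UDef L M fun i v => ∃ x, S i v x := by
  have h' := h.reindex (ι := ι ⊕ Unit) (fun o => o.elim (.inr ()) .inl)
  refine (ex_family (κ := Unit) (S := fun i v u => S i v (u ())) h').congr fun i v => ?_
  exact ⟨fun ⟨u, hu⟩ => ⟨_, hu⟩, fun ⟨x, hx⟩ => ⟨fun _ => x, hx⟩⟩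

theorem all {S : ∀ i, (ι → M i) → M i → Prop}
    (h : UDef L M (ι := Option ι) fun i w => S i (fun j => w (some j)) (w none)) :
    UDef L M fun i v => ∀ x, S i v x :=
  (ex (S := fun i v x => ¬ S i v x) h.not).not.congr fun i v => by simp

theorem all_finite [Finite κ] {S : κ → ∀ i, (ι → M i) → Prop} (h : ∀ k, UDef L M (S k)) :
    UDef L M fun i v => ∀ k, S k i v := by
  choose φ hφ using h
  exact ⟨Formula.iInf φ, fun i v => by simp [hφ]⟩

/-- Functions are available only through their graphs, so the values are named by a finite block of
existential quantifiers. -/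
theorem comp [Finite κ] {S : ∀ i, (κ → M i) → Prop} (hS : UDef L M S)
    {f : κ → ∀ i, (ι → M i) → M i} (hf : ∀ k, UFun L M (f k)) :
    UDef L M fun i v => S i fun k => f k i v := by
  have h : UDef L M fun i (v : ι → M i) => ∃ u : κ → M i, (∀ k, u k = f k i v) ∧ S i u := by
    refine ex_family (and (all_finite fun k => ?_) (hS.reindex Sum.inr))
    exact UDef.reindex (hf k).graph (fun o => o.elim (Sum.inr k) Sum.inl)
  refine h.congr fun i v => ⟨?_, fun h => ⟨_, fun k => rfl, h⟩⟩
  rintro ⟨u, hu, h⟩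
  rwa [← funext hu]

end UDef

theorem UFun.comp [Finite κ] {g : ∀ i, (κ → M i) → M i} (hg : UFun L M g)
    {f : κ → ∀ i, (ι → M i) → M i} (hf : ∀ k, UFun L M (f k)) :
    UFun L M fun i v => g i fun k => f k i v := by
  have h : UDef L M fun i (v : Option ι → M i) =>
      ∃ u : κ → M i, (∀ k, u k = f k i fun j => v (some j)) ∧ v none = g i u := by
    refine UDef.ex_family (UDef.and (UDef.all_finite fun k => ?_) ?_)
    · exact UDef.reindex (hf k).graph (fun o => o.elim (Sum.inr k) fun j => Sum.inl (some j))
    · exact UDef.reindex hg.graph (fun o => o.elim (Sum.inl none) Sum.inr)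
  refine ⟨UDef.congr h fun i v => ⟨?_, fun h => ⟨_, fun k => rfl, h⟩⟩⟩
  rintro ⟨u, hu, h⟩
  rw [h, funext hu]

theorem UFun.var (j : ι) : UFun L M fun _ v => v j :=
  ⟨⟨(Term.var none).equal (Term.var (some j)), fun _ _ => by simp⟩⟩

theorem UDef.eq {f g : ∀ i, (ι → M i) → M i} (hf : UFun L M f) (hg : UFun L M g) :
    UDef L M fun i v => f i v = g i v := by
  have h : UDef L M fun i (v : Fin 2 → M i) => v 0 = v 1 :=
    ⟨(Term.var 0).equal (Term.var 1), fun _ _ => by simp⟩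
  exact h.comp (f := ![f, g]) (by simp [Fin.forall_fin_two, hf, hg])

theorem UDef.rel {k : ℕ} (R : L.Relations k) {f : Fin k → ∀ i, (ι → M i) → M i}
    (hf : ∀ j, UFun L M (f j)) :
    UDef L M fun i v => Structure.RelMap R fun j => f j i v := by
  have h : UDef L M fun i (v : Fin k → M i) => Structure.RelMap R v :=
    ⟨Relations.formula R Term.var, fun _ _ => by simp [Formula.realize_rel]⟩
  exact h.comp hf

theorem UFun.func {k : ℕ} (R : L.Functions k) {f : Fin k → ∀ i, (ι → M i) → M i}
    (hf : ∀ j, UFun L M (f j)) :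
    UFun L M fun i v => Structure.funMap R fun j => f j i v := by
  have h : UFun L M fun i (v : Fin k → M i) => Structure.funMap R v :=
    ⟨⟨(Term.var none).equal (Term.func R fun j => Term.var (some j)), fun _ _ => by simp⟩⟩
  exact h.comp hf

/-- The family of the relations that a formula of arithmetic defines is uniformly definable. -/
theorem UDef.realize (F : arith →ᴸ L) [∀ i, arith.Structure (M i)] [∀ i, F.IsExpansionOn (M i)]
    {α : Type} {n : ℕ}
    (φ : arith.BoundedFormula α n) {g : α ⊕ Fin n → ι} :
    UDef L M fun i (v : ι → M i) => φ.Realize (fun a => v (g (.inl a))) fun j => v (g (.inr j)) :=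
  ⟨(F.onBoundedFormula φ).toFormula.relabel g, fun i v => by
    rw [Formula.realize_relabel, BoundedFormula.realize_toFormula,
      LHom.realize_onBoundedFormula]; rfl⟩

end UniformDefinability

/-! ## Arithmetical operations -/

/-- The symbols of arithmetic are interpreted in a structure by the given operations. -/
class Compat {L : FirstOrder.Language.{0, 0}} (F : arith →ᴸ L) (M : Type) [L.Structure M]
    [Zero M] [One M] [Add M] [Mul M] [LT M] : Prop where
  zero (v : Fin 0 → M) : Structure.funMap (F.onFunction ArithFunc.zero) v = 0
  one (v : Fin 0 → M) : Structure.funMap (F.onFunction ArithFunc.one) v = 1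
  add (v : Fin 2 → M) : Structure.funMap (F.onFunction ArithFunc.add) v = v 0 + v 1
  mul (v : Fin 2 → M) : Structure.funMap (F.onFunction ArithFunc.mul) v = v 0 * v 1
  lt (v : Fin 2 → M) : Structure.RelMap (F.onRelation ArithRel.lt) v ↔ v 0 < v 1

section

variable {M : Type} [arith.Structure M] {α : Type} (v : α → M)

@[simp] theorem realize_bv {n : ℕ} (i : Fin n) (xs : Fin n → M) :
    (bv i : arith.Term (α ⊕ Fin n)).realize (Sum.elim v xs) = xs i := rfl

@[simp] theorem realize_lift {n : ℕ} (t : arith.Term (α ⊕ Fin n)) (xs : Fin n → M) (x : M) :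
    (lift t).realize (Sum.elim v (Fin.snoc xs x : Fin (n + 1) → M)) =
      t.realize (Sum.elim v xs) := by
  rw [lift, Term.realize_relabel]
  congr 1
  ext (i | i) <;> simp

end

section Operations

variable {M : Type} [Zero M] [One M] [Add M] [Mul M] [LT M]

/-- The value `0 + 1 + ⋯ + 1` of a numeral. -/
def num (M : Type) [Zero M] [One M] [Add M] : ℕ → M
  | 0 => 0
  | n + 1 => num M n + 1

open Classical in
/-- The pairing function. -/
noncomputable def pr (x y : M) : M := if x < y then y * y + x else x * x + x + y

theorem num_nat (n : ℕ) : num ℕ n = n := by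
  induction n with
  | zero => rfl
  | succ n ih => rw [num, ih]

theorem pr_nat (a b : ℕ) : pr a b = Nat.pair a b := by
  by_cases h : a < b <;> simp [pr, Nat.pair, h]

variable [arith.Structure M] [Compat (LHom.id arith) M] {α : Type} (v : α → M)

@[simp] theorem realize_zero : (0 : arith.Term α).realize v = 0 :=
  Compat.zero (F := LHom.id arith) _

@[simp] theorem realize_one : (1 : arith.Term α).realize v = 1 :=
  Compat.one (F := LHom.id arith) _

@[simp] theorem realize_add (t s : arith.Term α) :
    (t + s).realize v = t.realize v + s.realize v :=
  Compat.add (F := LHom.id arith) _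

@[simp] theorem realize_mul (t s : arith.Term α) :
    (t * s).realize v = t.realize v * s.realize v :=
  Compat.mul (F := LHom.id arith) _

@[simp] theorem realize_numeral (n : ℕ) : (numeral n : arith.Term α).realize v = num M n := by
  induction n with
  | zero => exact realize_zero v
  | succ n ih => simp only [numeral, num, realize_add, realize_one, ih]

@[simp] theorem realize_ltF {n : ℕ} (t s : arith.Term (α ⊕ Fin n)) (xs : Fin n → M) :
    (ltF t s).Realize v xs ↔ t.realize (Sum.elim v xs) < s.realize (Sum.elim v xs) := by
  exact Compat.lt (F := LHom.id arith) _

@[simp] theorem realize_ballF {n : ℕ} (t : arith.Term (α ⊕ Fin n))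
    (φ : arith.BoundedFormula α (n + 1)) (xs : Fin n → M) :
    (ballF t φ).Realize v xs ↔ ∀ x < t.realize (Sum.elim v xs), φ.Realize v (Fin.snoc xs x) := by
  simp [ballF]

@[simp] theorem realize_bexF {n : ℕ} (t : arith.Term (α ⊕ Fin n))
    (φ : arith.BoundedFormula α (n + 1)) (xs : Fin n → M) :
    (bexF t φ).Realize v xs ↔ ∃ x < t.realize (Sum.elim v xs), φ.Realize v (Fin.snoc xs x) := by
  simp [bexF]

end Operations

instance : Compat (LHom.id arith) ℕ where
  zero _ := rfl
  one _ := rfl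
  add _ := rfl
  mul _ := rfl
  lt _ := Iff.rfl

section UniformOperations

variable {L : FirstOrder.Language.{0, 0}} {I : Type*} {M : I → Type} [∀ i, L.Structure (M i)]
  {ι : Type} [∀ i, Zero (M i)] [∀ i, One (M i)] [∀ i, Add (M i)] [∀ i, Mul (M i)] [∀ i, LT (M i)]
    {f g : ∀ i, (ι → M i) → M i}

theorem UFun.zero (F : arith →ᴸ L) [∀ i, Compat F (M i)] : UFun L M fun i (_ : ι → M i) => 0 := by
  have h := UFun.func (ι := ι) (M := M) (F.onFunction ArithFunc.zero) (f := fun j => j.elim0)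
    (fun j => j.elim0)
  simpa only [Compat.zero] using h

theorem UFun.one (F : arith →ᴸ L) [∀ i, Compat F (M i)] : UFun L M fun i (_ : ι → M i) => 1 := by
  have h := UFun.func (ι := ι) (M := M) (F.onFunction ArithFunc.one) (f := fun j => j.elim0)
    (fun j => j.elim0)
  simpa only [Compat.one] using h

theorem UFun.add (F : arith →ᴸ L) [∀ i, Compat F (M i)] (hf : UFun L M f) (hg : UFun L M g) :
    UFun L M fun i v => f i v + g i v := by
  have h := UFun.func (F.onFunction ArithFunc.add) (f := ![f, g])
    (by simp [Fin.forall_fin_two, hf, hg])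
  simp only [Compat.add] at h
  exact h

theorem UFun.mul (F : arith →ᴸ L) [∀ i, Compat F (M i)] (hf : UFun L M f) (hg : UFun L M g) :
    UFun L M fun i v => f i v * g i v := by
  have h := UFun.func (F.onFunction ArithFunc.mul) (f := ![f, g])
    (by simp [Fin.forall_fin_two, hf, hg])
  simp only [Compat.mul] at h
  exact h

theorem UDef.lt (F : arith →ᴸ L) [∀ i, Compat F (M i)] (hf : UFun L M f) (hg : UFun L M g) :
    UDef L M fun i v => f i v < g i v := by
  have h := UDef.rel (F.onRelation ArithRel.lt) (f := ![f, g])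
    (by simp [Fin.forall_fin_two, hf, hg])
  simp only [Compat.lt] at h
  exact h

theorem UFun.num (F : arith →ᴸ L) [∀ i, Compat F (M i)] (n : ℕ) : UFun L M fun i
    (_ : ι → M i) => num (M i) n := by
  induction n with
  | zero => exact UFun.zero F
  | succ n ih => exact UFun.add F ih (UFun.one F)

theorem UFun.pr (F : arith →ᴸ L) [∀ i, Compat F (M i)] (hf : UFun L M f) (hg : UFun L M g) :
    UFun L M fun i v => pr (f i v) (g i v) := by
  have h : UFun L M fun i (v : Fin 2 → M i) => TruthDef.pr (v 0) (v 1) := by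
    have h' : UDef L M fun i (v : Option (Fin 2) → M i) =>
        (v (some 0) < v (some 1) ∧ v none = v (some 1) * v (some 1) + v (some 0)) ∨
        (¬ v (some 0) < v (some 1) ∧
          v none = v (some 0) * v (some 0) + v (some 0) + v (some 1)) := by
      apply_rules [UDef.or, UDef.and, UDef.not, UDef.eq, UDef.lt F, UFun.var, UFun.add F,
        UFun.mul F]
    refine ⟨UDef.congr h' fun i v => ?_⟩
    by_cases hv : v (some 0) < v (some 1) <;> simp [TruthDef.pr, hv]
  exact h.comp (f := ![f, g]) (by simp [Fin.forall_fin_two, hf, hg])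

end UniformOperations

/-! ## Models of `PA⁻` -/

/-- The numerals form an initial segment that is isomorphic to the standard model. -/
structure IsEndExtension (M : Type) [Zero M] [One M] [Add M] [Mul M] [LT M] : Prop where
  num_one : num M 1 = 1
  num_add : ∀ a b, num M (a + b) = num M a + num M b
  num_mul : ∀ a b, num M (a * b) = num M a * num M b
  num_lt : ∀ a b, num M a < num M b ↔ a < b
  num_inj : Function.Injective (num M)
  exists_num : ∀ n x, x < num M n → ∃ m < n, x = num M m

section

variable {M : Type} [Zero M] [One M] [Add M] [Mul M] [LT M]

/-- `pr` is the expression that defines `Nat.pair`, and numerals respect `+`, `×` and `<`. Hence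
codes of standard expressions are computed in `M` as in `ℕ`. -/
theorem IsEndExtension.num_pair (h : IsEndExtension M) (a b : ℕ) :
    num M (Nat.pair a b) = pr (num M a) (num M b) := by
  by_cases hab : a < b <;> simp [pr, Nat.pair, h.num_lt, hab, h.num_add, h.num_mul]

variable [arith.Structure M] [Compat (LHom.id arith) M]

/-- By discreteness, a nonzero element below `n + 1` is a successor `z + 1` with `z < n`, so
induction on `n` shows that only numerals lie below a numeral. -/
theorem isEndExtension_of_PAminus (h : ∀ ψ, PAminus ψ → M ⊨ ψ) : IsEndExtension M := by
  have add_assoc := h _ .add_assoc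
  have add_comm := h _ .add_comm
  have mul_add := h _ .mul_add
  have add_zero := h _ .add_zero
  have mul_zero := h _ .mul_zero
  have mul_one := h _ .mul_one
  have lt_trans := h _ .lt_trans
  have lt_irrefl := h _ .lt_irrefl
  have lt_total := h _ .lt_total
  have add_lt := h _ .add_lt
  have lt_sub := h _ .lt_sub
  have zero_lt_one := h _ .zero_lt_one
  have one_le := h _ .one_le
  have zero_le := h _ .zero_le
  simp [Sentence.Realize, Formula.Realize, Fin.snoc] at *
  clear h
  have num_succ_ne (n : ℕ) : 0 < num M (n + 1) := by
    induction n with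
    | zero => simpa [num, add_comm 0, add_zero] using zero_lt_one
    | succ n ih =>
      have := add_lt _ _ 1 ih
      rw [add_comm, add_zero] at this
      exact lt_trans _ _ _ zero_lt_one this
  have num_add (a b : ℕ) : num M (a + b) = num M a + num M b := by
    induction b with
    | zero => exact (add_zero _).symm
    | succ b ih => rw [← Nat.add_assoc, num, ih, num, add_assoc]
  have num_mul (a b : ℕ) : num M (a * b) = num M a * num M b := by
    induction b with
    | zero => exact (mul_zero _).symm
    | succ b ih => rw [Nat.mul_succ, num_add, ih, num, mul_add, mul_one]
  have lt_num {a b : ℕ} (hab : a < b) : num M a < num M b := by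
    obtain ⟨c, rfl⟩ := Nat.exists_eq_add_of_lt hab
    have := add_lt _ _ (num M a) (num_succ_ne c)
    rwa [add_comm 0, add_zero, ← num_add, Nat.add_comm, ← Nat.add_assoc] at this
  have num_lt (a b : ℕ) : num M a < num M b ↔ a < b := by
    refine ⟨fun hab => ?_, lt_num⟩
    by_contra hba
    rcases (not_lt.1 hba).lt_or_eq with hba | rfl
    · exact lt_irrefl _ (lt_trans _ _ _ hab (lt_num hba))
    · exact lt_irrefl _ hab
  -- Cancellation is not an axiom; it follows from totality and monotonicity of addition.
  have of_add_lt {x y z : M} (hxy : x + z < y + z) : x < y := by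
    rcases lt_total x y with (hlt | rfl) | hlt
    · exact hlt
    · exact absurd hxy (lt_irrefl _)
    · exact absurd (lt_trans _ _ _ hxy (add_lt _ _ z hlt)) (lt_irrefl _)
  refine ⟨by rw [num, num, add_comm, add_zero], num_add, num_mul, num_lt, fun a b hab => ?_,
    fun n => ?_⟩
  · rcases lt_trichotomy a b with hlt | rfl | hlt
    · exact absurd (hab ▸ lt_num hlt) (lt_irrefl _)
    · rfl
    · exact absurd (hab ▸ lt_num hlt) (lt_irrefl _)
  · induction n with
    | zero =>
      intro x hx
      rcases zero_le x with h | rfl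
      · exact absurd (lt_trans _ _ _ hx h) (lt_irrefl _)
      · exact absurd hx (lt_irrefl _)
    | succ n ih =>
      intro x hx
      rcases zero_le x with h | rfl
      · obtain ⟨z, rfl⟩ : ∃ z, z + 1 = x := by
          rcases one_le x h with h | rfl
          · obtain ⟨z, rfl⟩ := lt_sub _ _ h
            exact ⟨z, add_comm _ _⟩
          · exact ⟨0, by rw [add_comm, add_zero]⟩
        obtain ⟨m, hm, rfl⟩ := ih z (of_add_lt hx)
        exact ⟨m + 1, Nat.succ_lt_succ hm, rfl⟩
      · exact ⟨0, n.succ_pos, rfl⟩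

end

/-! ## Absoluteness -/

section Absoluteness

theorem num_snoc {M : Type} [Zero M] [One M] [Add M] {n : ℕ} (xs : Fin n → ℕ) (x : ℕ) :
    (fun i => num M ((Fin.snoc xs x : Fin (n + 1) → ℕ) i)) =
      Fin.snoc (fun i => num M (xs i)) (num M x) := by
  ext i
  refine Fin.lastCases ?_ (fun i => ?_) i <;> simp

variable {M : Type} [Zero M] [One M] [Add M] [Mul M] [LT M] [arith.Structure M]
  [Compat (LHom.id arith) M] {α : Type}

theorem IsEndExtension.realize_term (hM : IsEndExtension M) (t : arith.Term α) (v : α → ℕ) :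
    t.realize (fun a => num M (v a)) = num M (t.realize v) := by
  induction t with
  | var => rfl
  | func f ts ih =>
    cases f with
    | zero => exact Compat.zero (F := LHom.id arith) _
    | one => exact (Compat.one (F := LHom.id arith) _).trans hM.num_one.symm
    | add =>
      refine (Compat.add (F := LHom.id arith) _).trans ?_
      rw [ih, ih, ← hM.num_add]
      rfl
    | mul =>
      refine (Compat.mul (F := LHom.id arith) _).trans ?_
      rw [ih, ih, ← hM.num_mul]
      rfl

theorem IsEndExtension.realize_bounded_term (hM : IsEndExtension M) {n : ℕ}
    (t : arith.Term (α ⊕ Fin n)) (v : α → ℕ) (xs : Fin n → ℕ) :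
    t.realize (Sum.elim (fun a => num M (v a)) fun i => num M (xs i)) =
      num M (t.realize (Sum.elim v xs)) := by
  rw [← hM.realize_term]
  congr 1
  ext (a | i) <;> rfl

theorem IsEndExtension.realize_isQF (hM : IsEndExtension M) {n : ℕ}
    {φ : arith.BoundedFormula α n} (hφ : φ.IsQF) (v : α → ℕ) (xs : Fin n → ℕ) :
    φ.Realize (fun a => num M (v a)) (fun i => num M (xs i)) ↔ φ.Realize v xs := by
  induction hφ with
  | falsum => rfl
  | of_isAtomic h =>
    cases h with
    | equal t s =>
      rw [BoundedFormula.realize_bdEqual, BoundedFormula.realize_bdEqual,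
        hM.realize_bounded_term, hM.realize_bounded_term, hM.num_inj.eq_iff]
    | rel R ts =>
      cases R
      refine (Compat.lt (F := LHom.id arith) _).trans ?_
      rw [hM.realize_bounded_term, hM.realize_bounded_term, hM.num_lt]
      rfl
  | imp _ _ ih₁ ih₂ => rw [BoundedFormula.realize_imp, BoundedFormula.realize_imp, ih₁, ih₂]

/-- At standard parameters a bounded quantifier ranges over numerals only, so it means the same in
`M` and in `ℕ`. -/
theorem IsEndExtension.realize_isDelta0 (hM : IsEndExtension M) {n : ℕ}
    {φ : arith.BoundedFormula α n} (hφ : IsDelta0 φ) (v : α → ℕ) (xs : Fin n → ℕ) :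
    φ.Realize (fun a => num M (v a)) (fun i => num M (xs i)) ↔ φ.Realize v xs := by
  induction hφ with
  | of_isQF h => exact hM.realize_isQF h v xs
  | imp _ _ ih₁ ih₂ => rw [BoundedFormula.realize_imp, BoundedFormula.realize_imp, ih₁, ih₂]
  | ball t _ ih =>
    rw [realize_ballF, realize_ballF, hM.realize_bounded_term]
    refine ⟨fun h x hx => ?_, fun h x hx => ?_⟩
    · rw [← ih, num_snoc]
      exact h _ ((hM.num_lt _ _).2 hx)
    · obtain ⟨m, hm, rfl⟩ := hM.exists_num _ _ hx
      rw [← num_snoc, ih]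
      exact h m hm
  | bex t _ ih =>
    rw [realize_bexF, realize_bexF, hM.realize_bounded_term]
    refine ⟨?_, fun ⟨x, hx, h⟩ => ⟨_, (hM.num_lt _ _).2 hx, ?_⟩⟩
    · rintro ⟨x, hx, h⟩
      obtain ⟨m, hm, rfl⟩ := hM.exists_num _ _ hx
      rw [← num_snoc, ih] at h
      exact ⟨m, hm, h⟩
    · rwa [← num_snoc, ih]

theorem IsEndExtension.realize_isPi_one (hM : IsEndExtension M) : ∀ {n : ℕ}
    {φ : arith.BoundedFormula α n}, IsPi 1 φ → ∀ (v : α → ℕ) (xs : Fin n → ℕ),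
    φ.Realize (fun a => num M (v a)) (fun i => num M (xs i)) → φ.Realize v xs
  | _, _, .of_sigma (.zero h), v, xs => (hM.realize_isDelta0 h v xs).1
  | _, _, .all h, v, xs => fun H x => by
    refine hM.realize_isPi_one h v _ ?_
    rw [num_snoc]
    exact H _

/-- Bounding the outer existential quantifiers of a `Σ₂` formula by a new variable `none` turns it
into a formula whose falsity is preserved in end-extensions. -/
theorem IsSigma.exists_bounded : ∀ {n : ℕ} {φ : arith.BoundedFormula α n}, IsSigma 2 φ →
    ∃ ψ : arith.BoundedFormula (Option α) n,
      (∀ (v : α → ℕ) xs, φ.Realize v xs ↔ ∃ k, ψ.Realize (fun o : Option α => o.elim k v) xs) ∧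
      (∀ (v : α → ℕ) xs k l, k ≤ l → ψ.Realize (fun o : Option α => o.elim k v) xs →
        ψ.Realize (fun o : Option α => o.elim l v) xs) ∧
      ∀ (M : Type) [Zero M] [One M] [Add M] [Mul M] [LT M] [arith.Structure M]
        [Compat (LHom.id arith) M], IsEndExtension M → ∀ (v : Option α → ℕ) xs,
        ψ.Realize (fun a => num M (v a)) (fun i => num M (xs i)) → ψ.Realize v xs
  | _, φ, .of_pi h => by
    -- A `Π₁` formula has no outer existential quantifier left to bound; the new variable does not
    -- occur.
    refine ⟨φ.subst fun a => Term.var (some a), ?_, ?_, ?_⟩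
    · simp [BoundedFormula.realize_subst]
    · simp [BoundedFormula.realize_subst]
    · intro M _ _ _ _ _ _ _ hM v xs
      simp only [BoundedFormula.realize_subst, Term.realize_var]
      exact hM.realize_isPi_one h _ _
  | _, _, .ex h => by
    obtain ⟨ψ, h₁, h₂, h₃⟩ := IsSigma.exists_bounded h
    refine ⟨bexF (Term.var (.inl none)) ψ, fun v xs => ?_, fun v xs k l hkl => ?_, ?_⟩
    · simp only [BoundedFormula.realize_ex, realize_bexF, Term.realize_var, Sum.elim_inl,
        Option.elim_none, h₁]
      constructor
      · rintro ⟨x, k, hk⟩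
        -- One bound serves all quantifiers: `x + 1` because the bound on `x` is strict, and `k` for
        -- the inner ones, by monotonicity.
        exact ⟨max (x + 1) k, x, by simp, h₂ _ _ _ _ (le_max_right _ _) hk⟩
      · rintro ⟨k, x, -, hk⟩
        exact ⟨x, k, hk⟩
    · simp only [realize_bexF, Term.realize_var, Sum.elim_inl, Option.elim_none]
      rintro ⟨x, hx, hk⟩
      exact ⟨x, hx.trans_le hkl, h₂ _ _ _ _ hkl hk⟩
    · intro M _ _ _ _ _ _ _ hM v xs
      simp only [realize_bexF, Term.realize_var, Sum.elim_inl]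
      rintro ⟨x, hx, hk⟩
      obtain ⟨m, hm, rfl⟩ := hM.exists_num _ _ hx
      rw [← num_snoc] at hk
      exact ⟨m, hm, h₃ M hM _ _ hk⟩

end Absoluteness

/-! ## Operations on codes -/

section Codes

variable {M : Type} [Zero M] [One M] [Add M] [Mul M] [LT M]

/-- The code of a sequence of length two. -/
noncomputable def vec2 (x y : M) : M := pr x (pr y (num M 0) + 1) + 1

/-- The code of a variable. -/
noncomputable def tmVar (i : M) : M := pr (num M 0) i

variable (M) in
/-- The code of the term `0`. -/
noncomputable def tmZero : M := pr (num M 1) (pr (num M 0) (num M 0))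

variable (M) in
/-- The code of the term `1`. -/
noncomputable def tmOne : M := pr (num M 1) (pr (num M 1) (num M 0))

/-- The code of a sum. -/
noncomputable def tmAdd (t s : M) : M := pr (num M 1) (pr (num M 2) (vec2 t s))

/-- The code of a product. -/
noncomputable def tmMul (t s : M) : M := pr (num M 1) (pr (num M 3) (vec2 t s))

variable (M) in
/-- The code of `⊥`. -/
noncomputable def fmBot : M := pr (num M 0) (num M 0)

/-- The code of an equation. -/
noncomputable def fmEq (t s : M) : M := pr (num M 1) (pr t s)

/-- The code of an inequality. -/
noncomputable def fmLt (t s : M) : M := pr (num M 2) (pr (num M 0) (vec2 t s))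

/-- The code of an implication. -/
noncomputable def fmImp (c d : M) : M := pr (num M 3) (pr c d)

/-- The code of a universal quantification. -/
noncomputable def fmAll (c : M) : M := pr (num M 4) c

/-- The code of `∀ x, x = t → φ`, where `t` is a term with the code `t` and `φ` a formula with the
code `c`. -/
noncomputable def fmInst (c t : M) : M := fmAll (fmImp (fmEq (tmVar (num M 0)) t) c)

namespace IsEndExtension

theorem num_vec2 (h : IsEndExtension M) (a b : ℕ) : num M (vec2 a b) = vec2 (num M a)
    (num M b) := by
  simp only [vec2, pr_nat, num_nat, h.num_add, h.num_pair, h.num_one]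

theorem num_tmVar (h : IsEndExtension M) (a : ℕ) : num M (tmVar a) = tmVar (num M a) := by
  simp only [tmVar, pr_nat, num_nat, h.num_pair]

theorem num_tmZero (h : IsEndExtension M) : num M (tmZero ℕ) = tmZero M := by
  simp only [tmZero, pr_nat, num_nat, h.num_pair]

theorem num_tmOne (h : IsEndExtension M) : num M (tmOne ℕ) = tmOne M := by
  simp only [tmOne, pr_nat, num_nat, h.num_pair]

theorem num_tmAdd (h : IsEndExtension M) (a b : ℕ) : num M (tmAdd a b) = tmAdd (num M a)
    (num M b) := by
  simp only [tmAdd, pr_nat, num_nat, h.num_pair, h.num_vec2]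

theorem num_tmMul (h : IsEndExtension M) (a b : ℕ) : num M (tmMul a b) = tmMul (num M a)
    (num M b) := by
  simp only [tmMul, pr_nat, num_nat, h.num_pair, h.num_vec2]

theorem num_fmBot (h : IsEndExtension M) : num M (fmBot ℕ) = fmBot M := by
  simp only [fmBot, pr_nat, num_nat, h.num_pair]

theorem num_fmEq (h : IsEndExtension M) (a b : ℕ) : num M (fmEq a b) = fmEq (num M a)
    (num M b) := by
  simp only [fmEq, pr_nat, num_nat, h.num_pair]

theorem num_fmLt (h : IsEndExtension M) (a b : ℕ) : num M (fmLt a b) = fmLt (num M a)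
    (num M b) := by
  simp only [fmLt, pr_nat, num_nat, h.num_pair, h.num_vec2]

theorem num_fmImp (h : IsEndExtension M) (a b : ℕ) : num M (fmImp a b) = fmImp (num M a)
    (num M b) := by
  simp only [fmImp, pr_nat, num_nat, h.num_pair]

theorem num_fmAll (h : IsEndExtension M) (a : ℕ) : num M (fmAll a) = fmAll (num M a) := by
  simp only [fmAll, pr_nat, num_nat, h.num_pair]

theorem num_fmInst (h : IsEndExtension M) (a b : ℕ) : num M (fmInst a b) = fmInst (num M a)
    (num M b) := by
  simp only [fmInst, h.num_fmAll, h.num_fmImp, h.num_fmEq, h.num_tmVar, num_nat]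

end IsEndExtension

theorem codeVec_zero (v : Fin 0 → ℕ) : codeVec v = num ℕ 0 := by
  simp [codeVec, num_nat]

/-- The encoding of lists sends the empty list to `0` and a list with head `a` and tail `l` to the
successor of the pair of `a` and the code of `l`. -/
theorem codeVec_two (v : Fin 2 → ℕ) : codeVec v = vec2 (v 0) (v 1) := by
  simp [codeVec, vec2, pr_nat, num_nat]

variable {n : ℕ}

theorem codeTerm_zero :
    codeTerm (incl.onTerm (0 : arith.Term (Empty ⊕ Fin n))) = tmZero ℕ := by
  change Nat.pair 1 (Nat.pair 0 (codeVec _)) = _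
  simp [codeVec_zero, tmZero, pr_nat, num_nat]

theorem codeTerm_one :
    codeTerm (incl.onTerm (1 : arith.Term (Empty ⊕ Fin n))) = tmOne ℕ := by
  change Nat.pair 1 (Nat.pair 1 (codeVec _)) = _
  simp [codeVec_zero, tmOne, pr_nat, num_nat]

theorem codeTerm_add (t s : arith.Term (Empty ⊕ Fin n)) :
    codeTerm (incl.onTerm (t + s)) =
      tmAdd (codeTerm (incl.onTerm t)) (codeTerm (incl.onTerm s)) := by
  change Nat.pair 1 (Nat.pair 2 (codeVec _)) = _
  rw [codeVec_two]
  simp only [tmAdd, pr_nat, num_nat]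
  rfl

theorem codeTerm_mul (t s : arith.Term (Empty ⊕ Fin n)) :
    codeTerm (incl.onTerm (t * s)) =
      tmMul (codeTerm (incl.onTerm t)) (codeTerm (incl.onTerm s)) := by
  change Nat.pair 1 (Nat.pair 3 (codeVec _)) = _
  rw [codeVec_two]
  simp only [tmMul, pr_nat, num_nat]
  rfl

/-- The code of a numeral. -/
noncomputable def numCode : ℕ → ℕ
  | 0 => tmZero ℕ
  | x + 1 => tmAdd (numCode x) (tmOne ℕ)

theorem codeTerm_numeral (x : ℕ) :
    codeTerm (incl.onTerm (numeral x : arith.Term (Empty ⊕ Fin n))) = numCode x := by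
  induction x with
  | zero => exact codeTerm_zero
  | succ x ih => rw [numeral, codeTerm_add, ih, codeTerm_one, numCode]

/-- The sentence `∀ x, x = n → φ(x)`. -/
def inst (φ : arithPreds.BoundedFormula Empty 1) (n : ℕ) : arithPreds.Sentence :=
  ∀' ((Term.var (Sum.inr 0)).bdEqual (incl.onTerm (numeral n)) ⟹ φ)

/-- Writing an instance as a quantified implication avoids arithmetizing substitution: its code is
an explicit expression in the code of the formula and the code of the numeral. Both diagonal
arguments rest on this. -/
theorem code_inst (φ : arithPreds.BoundedFormula Empty 1) (n : ℕ) :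
    code (inst φ n) = fmInst (code φ) (numCode n) := by
  rw [← codeTerm_numeral (n := 1)]
  simp only [fmInst, fmAll, fmImp, fmEq, tmVar, pr_nat, num_nat]
  rfl

end Codes

/-! ## Axioms for truth -/

section Axioms

variable {M : Type} [Zero M] [One M] [Add M] [Mul M] [LT M]

/-- `Num x y` says that `y` is the code of the numeral `x`. -/
def NumAxioms (Num : M → M → Prop) : Prop :=
  Num 0 (tmZero M) ∧ (∀ x y, Num x y → Num (x + 1) (tmAdd y (tmOne M))) ∧
    ∀ x y z, Num x y → Num x z → y = z

/-- The assignment `b` maps `n` to `x` and agrees with `a` below `n`. -/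
def Ext (E : M → M → M → Prop) (n a x b : M) : Prop :=
  E b n x ∧ ∀ i, i < n → ∀ y, E b i y ↔ E a i y

/-- `E a i x` says that the assignment `a` maps `i` to `x`. -/
def EnvAxioms (E : M → M → M → Prop) : Prop :=
  (∀ n a x, ∃ b, Ext E n a x b) ∧ ∀ a i x y, E a i x → E a i y → x = y

/-- `Val t a x` says that, under the assignment `a`, the term with the code `t` has the value `x`.
Only terms whose code has the property `P` are considered. -/
def ValAxioms (P : M → Prop) (E Val : M → M → M → Prop) : Prop :=
  (∀ i a x, P (tmVar i) → (Val (tmVar i) a x ↔ E a i x)) ∧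
  (∀ a x, P (tmZero M) → (Val (tmZero M) a x ↔ x = 0)) ∧
  (∀ a x, P (tmOne M) → (Val (tmOne M) a x ↔ x = 1)) ∧
  (∀ t s a x, P (tmAdd t s) →
    (Val (tmAdd t s) a x ↔ ∃ y z, Val t a y ∧ Val s a z ∧ x = y + z)) ∧
  ∀ t s a x, P (tmMul t s) →
    (Val (tmMul t s) a x ↔ ∃ y z, Val t a y ∧ Val s a z ∧ x = y * z)

/-- `Sat n c a` says that the formula with the code `c` and the free variables `0, …, n - 1` is
satisfied by the assignment `a`. Only formulae whose code has the property `P` are considered. -/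
def SatAxioms (P : M → Prop) (E Val Sat : M → M → M → Prop) : Prop :=
  (∀ n a, P (fmBot M) → ¬ Sat n (fmBot M) a) ∧
  (∀ n t s a, P (fmEq t s) → (Sat n (fmEq t s) a ↔ ∃ x, Val t a x ∧ Val s a x)) ∧
  (∀ n t s a, P (fmLt t s) → (Sat n (fmLt t s) a ↔ ∃ x y, Val t a x ∧ Val s a y ∧ x < y)) ∧
  (∀ n c d a, P (fmImp c d) → (Sat n (fmImp c d) a ↔ (Sat n c a → Sat n d a))) ∧
  ∀ n c a, P (fmAll c) → (Sat n (fmAll c) a ↔ ∀ x b, Ext E n a x b → Sat (n + 1) c b)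

/-- Induction for the relations that `Sat` defines. -/
def IndAxiom (E Sat : M → M → M → Prop) : Prop :=
  ∀ n c a, (∀ b, Ext E n a 0 b → Sat (n + 1) c b) →
    (∀ x, (∀ b, Ext E n a x b → Sat (n + 1) c b) → ∀ b, Ext E n a (x + 1) b → Sat (n + 1) c b) →
    ∀ x b, Ext E n a x b → Sat (n + 1) c b

/-- The bound `c` and the code of the instance of the formula with the code `u` at the numeral `u`
do not satisfy `G`. -/
def Guard [arith.Structure M] (G : arith.BoundedFormula (Option (Fin 1)) 0) (Num : M → M → Prop)
    (u c : M) : Prop :=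
  ∀ y, Num u y → ¬ G.Realize (fun o : Option (Fin 1) => o.elim c fun _ => fmInst u y) default

/-- The axiom that exponentiation is total. -/
def expAxiom : arith.Sentence := ∀' ∀' ∃' expF

end Axioms

/-- The `i`-th additional relation symbol of arity `k`. -/
def sym (k i : ℕ) : arithPreds.Relations k := Sum.inr i

section Relations

variable {M : Type} [arithPreds.Structure M]

/-- The interpretation of a binary relation symbol. -/
def rel2 (i : ℕ) (x y : M) : Prop := Structure.RelMap (sym 2 i) ![x, y]

/-- The interpretation of a ternary relation symbol. -/
def rel3 (i : ℕ) (x y z : M) : Prop := Structure.RelMap (sym 3 i) ![x, y, z]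

end Relations

/-- The axioms of a guarded definition of truth. -/
def Spec (G : arith.BoundedFormula (Option (Fin 1)) 0) {M : Type} [Zero M] [One M] [Add M] [Mul M]
    [LT M] [arith.Structure M] [arithPreds.Structure M] (u : M) : Prop :=
  (∀ ψ, PAminus ψ → M ⊨ ψ) ∧ M ⊨ expAxiom ∧ NumAxioms (M := M) (rel2 0) ∧
  EnvAxioms (M := M) (rel3 0) ∧
  ValAxioms (Guard G (rel2 0) u) (rel3 0) (rel3 1) ∧
  SatAxioms (Guard G (rel2 0) u) (rel3 0) (rel3 1) (rel3 2) ∧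
  IndAxiom (M := M) (rel3 0) (rel3 2)

/-! ## Uniform definability of the axioms -/

/-- A structure for the extended language. -/
structure Model where
  /-- The domain. -/
  carrier : Type
  [str : arithPreds.Structure carrier]

namespace Model

instance : CoeSort Model Type := ⟨carrier⟩

variable (A : Model)

instance : arithPreds.Structure A := A.str
instance : arith.Structure A := incl.reduct A
instance : incl.IsExpansionOn (A : Type) := LHom.isExpansionOn_reduct _ _
instance : Zero A := ⟨Structure.funMap (L := arith) ArithFunc.zero ![]⟩
instance : One A := ⟨Structure.funMap (L := arith) ArithFunc.one ![]⟩
instance : Add A := ⟨fun x y => Structure.funMap (L := arith) ArithFunc.add ![x, y]⟩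
instance : Mul A := ⟨fun x y => Structure.funMap (L := arith) ArithFunc.mul ![x, y]⟩
instance : LT A := ⟨fun x y => Structure.RelMap (L := arith) ArithRel.lt ![x, y]⟩

instance : Compat (LHom.id arith) A where
  zero v := congrArg _ (Subsingleton.elim v _)
  one v := congrArg _ (Subsingleton.elim v _)
  add v := by rw [← FinVec.etaExpand_eq v]; rfl
  mul v := by rw [← FinVec.etaExpand_eq v]; rfl
  lt v := by rw [← FinVec.etaExpand_eq v]; rfl

instance : Compat incl (A : Type) where
  zero := Compat.zero (F := LHom.id arith) (M := A)
  one := Compat.one (F := LHom.id arith) (M := A)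
  add := Compat.add (F := LHom.id arith) (M := A)
  mul := Compat.mul (F := LHom.id arith) (M := A)
  lt := Compat.lt (F := LHom.id arith) (M := A)

end Model

/-- Finiteness allows `PA⁻` to be part of a single sentence. -/
theorem finite_PAminus : ∃ l : List {ψ // PAminus ψ}, ∀ ψ, PAminus ψ → ∃ χ ∈ l, χ.1 = ψ :=
  ⟨[⟨_, .add_assoc⟩, ⟨_, .add_comm⟩, ⟨_, .mul_assoc⟩, ⟨_, .mul_comm⟩, ⟨_, .mul_add⟩,
    ⟨_, .add_zero⟩, ⟨_, .mul_zero⟩, ⟨_, .mul_one⟩, ⟨_, .lt_trans⟩, ⟨_, .lt_irrefl⟩, ⟨_, .lt_total⟩,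
    ⟨_, .add_lt⟩, ⟨_, .mul_lt⟩, ⟨_, .lt_sub⟩, ⟨_, .zero_lt_one⟩, ⟨_, .one_le⟩, ⟨_, .zero_le⟩], by
    rintro _ (_ | _) <;> simp only [List.exists_mem_cons_iff, true_or, or_true]⟩

section

variable {ι : Type}

theorem UDef.sentence (ψ : arith.Sentence) :
    UDef arithPreds Model.carrier fun A (_ : ι → A) => A ⊨ ψ := by
  refine (UDef.realize incl ψ (M := Model.carrier) (ι := Empty) (g := Sum.elim id
    Fin.elim0)).reindex
    (Empty.elim) |>.congr fun A v => ?_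
  rw [Sentence.Realize, Formula.Realize]
  congr!

theorem UDef.rel2 (i : ℕ) {f g : ∀ A : Model, (ι → A) → A} (hf : UFun arithPreds Model.carrier f)
    (hg : UFun arithPreds Model.carrier g) :
    UDef arithPreds Model.carrier fun A (v : ι → A) => rel2 i (f A v) (g A v) := by
  refine (UDef.rel (sym 2 i) (f := ![f, g]) (by simp [Fin.forall_fin_two, hf, hg])).congr
    fun A v => ?_
  rw [TruthDef.rel2]
  congr! with j
  fin_cases j <;> rfl

theorem UDef.rel3 (i : ℕ) {f g h : ∀ A : Model, (ι → A) → A} (hf : UFun arithPreds Model.carrier f)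
    (hg : UFun arithPreds Model.carrier g) (hh : UFun arithPreds Model.carrier h) :
    UDef arithPreds Model.carrier fun A (v : ι → A) => rel3 i (f A v) (g A v) (h A v) := by
  refine (UDef.rel (sym 3 i) (f := ![f, g, h]) (by simp [Fin.forall_fin_succ, hf, hg, hh])).congr
    fun A v => ?_
  rw [TruthDef.rel3]
  congr! with j
  fin_cases j <;> rfl

theorem UDef.guard (G : arith.BoundedFormula (Option (Fin 1)) 0) {f g : ∀ A : Model, (ι → A) → A}
    (hf : UFun arithPreds Model.carrier f) (hg : UFun arithPreds Model.carrier g) :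
    UDef arithPreds Model.carrier fun A (v : ι → A) => Guard G (TruthDef.rel2 0) (f A v)
      (g A v) := by
  have h : UDef arithPreds Model.carrier fun A (v : Fin 3 → A) =>
      G.Realize (fun o : Option (Fin 1) => o.elim (v 1) fun _ => fmInst (v 0) (v 2)) default := by
    refine ((UDef.realize incl G (M := Model.carrier)
      (g := Sum.elim (Option.elim · none some) Fin.elim0)).comp
      (f := fun o A v => o.elim (v 1) fun _ => fmInst (v 0) (v 2)) ?_).congr fun A v => ?_
    · rintro (_ | o)
      · exact UFun.var 1
      · unfold fmInst fmAll fmImp fmEq tmVar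
        apply_rules (maxDepth := 200) [UFun.var, UFun.num incl, UFun.pr incl]
    · congr! with o
      cases o <;> rfl
  have h' : UDef arithPreds Model.carrier fun A (v : Fin 2 → A) =>
      Guard G (TruthDef.rel2 0) (v 0) (v 1) :=
    .all (.imp (.rel2 _ (.var _) (.var _)) (.not
      (h.reindex (ι := Option (Fin 2)) ![some 0, some 1, none])))
  exact h'.comp (f := ![f, g]) (by simp [Fin.forall_fin_two, hf, hg])

end

/-- The parameter `u` is kept as a free variable so that the resulting formula can be instantiated
at its own code. -/
theorem uDef_spec (G : arith.BoundedFormula (Option (Fin 1)) 0) :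
    UDef arithPreds Model.carrier fun A (v : Fin 1 → A) => Spec G (v 0) := by
  refine .and ?_ (.and (.sentence _) (.and ?_ (.and ?_ (.and ?_ (.and ?_ ?_)))))
  · obtain ⟨l, hl⟩ := finite_PAminus
    refine (UDef.all_finite (κ := Fin l.length) fun k => .sentence (l.get k).1).congr fun A v => ?_
    refine ⟨fun h ψ hψ => ?_, fun h k => h _ (l.get k).2⟩
    obtain ⟨χ, hχ, rfl⟩ := hl ψ hψ
    obtain ⟨k, rfl⟩ := List.get_of_mem hχ
    exact h k
  · unfold NumAxioms tmZero tmAdd tmOne vec2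
    apply_rules (maxDepth := 200) [UDef.guard, UDef.rel2, UDef.rel3, UDef.lt incl, UDef.false,
      UDef.and,
      UDef.iff, UDef.imp, UDef.eq, UDef.all, UDef.ex, UFun.var, UFun.zero incl, UFun.one incl,
      UFun.num incl, UFun.add incl, UFun.mul incl, UFun.pr incl]
  · unfold EnvAxioms Ext
    apply_rules (maxDepth := 200) [UDef.guard, UDef.rel2, UDef.rel3, UDef.lt incl, UDef.false,
      UDef.and,
      UDef.iff, UDef.imp, UDef.eq, UDef.all, UDef.ex, UFun.var, UFun.zero incl, UFun.one incl,
      UFun.num incl, UFun.add incl, UFun.mul incl, UFun.pr incl]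
  · unfold ValAxioms tmZero tmAdd tmMul tmOne vec2 tmVar
    apply_rules (maxDepth := 200) [UDef.guard, UDef.rel2, UDef.rel3, UDef.lt incl, UDef.false,
      UDef.and,
      UDef.iff, UDef.imp, UDef.eq, UDef.all, UDef.ex, UFun.var, UFun.zero incl, UFun.one incl,
      UFun.num incl, UFun.add incl, UFun.mul incl, UFun.pr incl]
  · unfold SatAxioms fmBot fmEq fmLt fmImp fmAll Ext vec2
    apply_rules (maxDepth := 200) [UDef.guard, UDef.rel2, UDef.rel3, UDef.lt incl, UDef.false,
      UDef.and,
      UDef.iff, UDef.imp, UDef.eq, UDef.all, UDef.ex, UFun.var, UFun.zero incl, UFun.one incl,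
      UFun.num incl, UFun.add incl, UFun.mul incl, UFun.pr incl]
  · unfold IndAxiom Ext
    apply_rules (maxDepth := 200) [UDef.guard, UDef.rel2, UDef.rel3, UDef.lt incl, UDef.false,
      UDef.and,
      UDef.iff, UDef.imp, UDef.eq, UDef.all, UDef.ex, UFun.var, UFun.zero incl, UFun.one incl,
      UFun.num incl, UFun.add incl, UFun.mul incl, UFun.pr incl]

/-! ## Truth in models of the axioms -/

section Truth

variable {M : Type} [Zero M] [One M] [Add M] [Mul M] [LT M]

/-- The assignment `a` maps `i` to `v i` for all `i < n`. -/
def Represents (E : M → M → M → Prop) {n : ℕ} (a : M) (v : Fin n → M) : Prop :=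
  ∀ i : Fin n, E a (num M i) (v i)

variable {P : M → Prop} {E Val Sat : M → M → M → Prop}

theorem Represents.snoc (hM : IsEndExtension M) {n : ℕ} {a : M} {v : Fin n → M}
    (h : Represents E a v) {x b : M} (hb : Ext E (num M n) a x b) :
    Represents E b (Fin.snoc v x : Fin (n + 1) → M) := by
  refine Fin.lastCases ?_ fun i => ?_
  · simpa using hb.1
  · simpa using (hb.2 _ ((hM.num_lt _ _).2 i.2) _).2 (h i)

/-- The entries may be nonstandard but the length is standard, so finitely many extensions of an
arbitrary assignment suffice. -/
theorem exists_represents (hM : IsEndExtension M) (hE : EnvAxioms E) {n : ℕ} (v : Fin n → M) :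
    ∃ a, Represents E a v := by
  induction n with
  | zero => exact ⟨0, fun i => i.elim0⟩
  | succ n ih =>
    obtain ⟨a, ha⟩ := ih (Fin.init v)
    obtain ⟨b, hb⟩ := hE.1 (num M n) a (v (Fin.last n))
    refine ⟨b, ?_⟩
    rw [← Fin.snoc_init_self v]
    exact ha.snoc hM hb

variable [arith.Structure M] [Compat (LHom.id arith) M]

theorem val_iff (hM : IsEndExtension M) (hP : ∀ n : ℕ, P (num M n)) (hE : EnvAxioms E)
    (hV : ValAxioms P E Val) {n : ℕ} (t : arith.Term (Empty ⊕ Fin n)) {a : M} {v : Fin n → M}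
    (ha : Represents E a v) (x : M) :
    Val (num M (codeTerm (incl.onTerm t))) a x ↔ x = t.realize (Sum.elim default v) := by
  obtain ⟨h₀, h₁, h₂, h₃, h₄⟩ := hV
  induction t generalizing x with
  | var i =>
    obtain i | i := i
    · exact i.elim
    · have : codeTerm (incl.onTerm (Term.var (Sum.inr i))) = tmVar (i : ℕ) := by
        simp only [tmVar, pr_nat, num_nat]
        rfl
      rw [this, hM.num_tmVar, h₀ _ _ _ (hM.num_tmVar i ▸ hP _)]
      exact ⟨fun h => hE.2 _ _ _ _ h (ha i), fun h => h ▸ ha i⟩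
  | func f ts ih =>
    cases f with
    | zero =>
      have e : Term.func ArithFunc.zero ts = (0 : arith.Term (Empty ⊕ Fin n)) :=
        congrArg _ (Subsingleton.elim _ _)
      rw [e, codeTerm_zero, hM.num_tmZero, h₁ _ _ (hM.num_tmZero ▸ hP _), realize_zero]
    | one =>
      have e : Term.func ArithFunc.one ts = (1 : arith.Term (Empty ⊕ Fin n)) :=
        congrArg _ (Subsingleton.elim _ _)
      rw [e, codeTerm_one, hM.num_tmOne, h₂ _ _ (hM.num_tmOne ▸ hP _), realize_one]
    | add =>
      have e : Term.func ArithFunc.add ts = ts 0 + ts 1 :=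
        congrArg _ (FinVec.etaExpand_eq ts).symm
      rw [e, codeTerm_add, hM.num_tmAdd, h₃ _ _ _ _ (hM.num_tmAdd _ _ ▸ hP _), realize_add]
      simp [ih]
    | mul =>
      have e : Term.func ArithFunc.mul ts = ts 0 * ts 1 :=
        congrArg _ (FinVec.etaExpand_eq ts).symm
      rw [e, codeTerm_mul, hM.num_tmMul, h₄ _ _ _ _ (hM.num_tmMul _ _ ▸ hP _), realize_mul]
      simp [ih]

/-- External induction on `φ`: all codes that occur are standard, so the guard `P` never blocks a
clause. `Sat` carries the number `n` of free variables because a quantifier in the scope of `n`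
variables binds the variable with index `n`, and the code does not record `n`. -/
theorem sat_iff (hM : IsEndExtension M) (hP : ∀ n : ℕ, P (num M n)) (hE : EnvAxioms E)
    (hV : ValAxioms P E Val) (hS : SatAxioms P E Val Sat) {n : ℕ} (φ : arith.BoundedFormula Empty n)
    {a : M} {v : Fin n → M} (ha : Represents E a v) :
    Sat (num M n) (num M (code (incl.onBoundedFormula φ))) a ↔ φ.Realize default v := by
  obtain ⟨h₀, h₁, h₂, h₃, h₄⟩ := hS
  induction φ generalizing a with
  | falsum =>
    have e {n : ℕ} : code (incl.onBoundedFormula (.falsum : arith.BoundedFormula Empty n)) =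
        fmBot ℕ := by
      simp only [fmBot, pr_nat, num_nat]
      rfl
    rw [e, hM.num_fmBot]
    exact iff_of_false (h₀ _ _ (hM.num_fmBot ▸ hP _)) id
  | equal t s =>
    have e : code (incl.onBoundedFormula (.equal t s)) =
        fmEq (codeTerm (incl.onTerm t)) (codeTerm (incl.onTerm s)) := by
      simp only [fmEq, pr_nat, num_nat]
      rfl
    rw [e, hM.num_fmEq, h₁ _ _ _ _ (hM.num_fmEq _ _ ▸ hP _)]
    simp [val_iff hM hP hE hV _ ha, BoundedFormula.Realize]
  | rel R ts =>
    cases R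
    have e : code (incl.onBoundedFormula (.rel ArithRel.lt ts)) =
        fmLt (codeTerm (incl.onTerm (ts 0))) (codeTerm (incl.onTerm (ts 1))) := by
      change Nat.pair 2 (Nat.pair 0 (codeVec _)) = _
      rw [codeVec_two]
      simp only [fmLt, pr_nat, num_nat]
      rfl
    rw [e, hM.num_fmLt, h₂ _ _ _ _ (hM.num_fmLt _ _ ▸ hP _)]
    simp only [val_iff hM hP hE hV _ ha]
    refine Iff.trans ?_ (Compat.lt (F := LHom.id arith) _).symm
    simp
  | imp φ ψ ih₁ ih₂ =>
    have e : code (incl.onBoundedFormula (φ ⟹ ψ)) =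
        fmImp (code (incl.onBoundedFormula φ)) (code (incl.onBoundedFormula ψ)) := by
      simp only [fmImp, pr_nat, num_nat]
      rfl
    rw [e, hM.num_fmImp, h₃ _ _ _ _ (hM.num_fmImp _ _ ▸ hP _), ih₁ ha, ih₂ ha]
    rfl
  | @all n φ ih =>
    have e : code (incl.onBoundedFormula (∀' φ)) = fmAll (code (incl.onBoundedFormula φ)) := by
      simp only [fmAll, pr_nat, num_nat]
      rfl
    rw [e, hM.num_fmAll, h₄ _ _ _ (hM.num_fmAll _ ▸ hP _), BoundedFormula.realize_all]
    refine ⟨fun h x => ?_, fun h x b hb => ?_⟩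
    · obtain ⟨b, hb⟩ := hE.1 (num M n) a x
      exact (ih (ha.snoc hM hb)).1 (h x b hb)
    · exact (ih (ha.snoc hM hb)).2 (h x)

/-- The single axiom `IndAxiom`, taken at the standard code of `φ` and at an assignment that
represents the parameters, is the induction axiom for `φ`, by `sat_iff`. -/
theorem realize_inductionAxiom (hM : IsEndExtension M) (hP : ∀ n : ℕ, P (num M n))
    (hE : EnvAxioms E) (hV : ValAxioms P E Val) (hS : SatAxioms P E Val Sat) (hI : IndAxiom E Sat)
    {n : ℕ} (φ : arith.Formula (Fin (n + 1))) : M ⊨ inductionAxiom φ := by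
  rw [inductionAxiom, Sentence.Realize, BoundedFormula.realize_alls]
  intro v
  obtain ⟨a, ha⟩ := exists_represents hM hE v
  have key (x : M) : (∀ b, Ext E (num M n) a x b → Sat (num M n + 1)
      (num M (code (incl.onBoundedFormula
        (BoundedFormula.relabel (k := 0) Sum.inr φ : arith.BoundedFormula Empty (n + 1))))) b) ↔
      φ.Realize (Fin.snoc v x : Fin (n + 1) → M) := by
    rw [← Formula.realize_relabel_sumInr (v := default) φ]
    refine ⟨fun h => ?_, fun h b hb => ?_⟩
    · obtain ⟨b, hb⟩ := hE.1 (num M n) a x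
      exact (sat_iff hM hP hE hV hS _ (ha.snoc hM hb)).1 (h b hb)
    · exact (sat_iff hM hP hE hV hS _ (ha.snoc hM hb)).2 h
  have hI := hI (num M n) (num M (code (incl.onBoundedFormula
        (BoundedFormula.relabel (k := 0) Sum.inr φ : arith.BoundedFormula Empty (n + 1))))) a
  simp only [key] at hI
  simp only [BoundedFormula.realize_imp, BoundedFormula.realize_inf, BoundedFormula.realize_all]
  rintro ⟨h₀, h₁⟩ x
  refine (Formula.realize_relabel_sumInr φ).2 (hI ?_ (fun y hy => ?_) x)
  · have := (Formula.realize_relabel_sumInr _).1 h₀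
    rw [Formula.Realize, BoundedFormula.realize_subst] at this
    rw [Formula.Realize]
    convert this using 2 with i
    refine Fin.lastCases ?_ (fun i => ?_) i <;> simp
  · have := (Formula.realize_relabel_sumInr _).1 (h₁ y ((Formula.realize_relabel_sumInr φ).2 hy))
    rw [Formula.Realize, BoundedFormula.realize_subst] at this
    rw [Formula.Realize]
    convert this using 2 with i
    refine Fin.lastCases ?_ (fun i => ?_) i <;> simp

end Truth

/-! ## The standard model of the axioms -/

theorem exists_beta (f : ℕ → ℕ) (n : ℕ) : ∃ b, ∀ i < n, Nat.beta b i = f i := by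
  refine ⟨Nat.unbeta (List.ofFn fun i : Fin n => f i), fun i hi => ?_⟩
  simpa using Nat.beta_unbeta_coe (List.ofFn fun i : Fin n => f i) ⟨i, by simpa using hi⟩

/-- This makes recursion on codes terminate: every compound expression has a nonzero tag. With tag
`0` it may fail, as for the pair of `0` and `1`, whose code is `1`. -/
theorem unpair_snd_lt {n : ℕ} (h : n.unpair.1 ≠ 0) : n.unpair.2 < n := by
  conv_rhs => rw [← Nat.pair_unpair n]
  generalize n.unpair.1 = a at *
  generalize n.unpair.2 = b at *
  unfold Nat.pair
  split_ifs <;> nlinarith [Nat.pos_of_ne_zero h]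

/-- The first entry of a sequence of length two. -/
def vecFst (w : ℕ) : ℕ := (w - 1).unpair.1

/-- The second entry of a sequence of length two. -/
def vecSnd (w : ℕ) : ℕ := ((w - 1).unpair.2 - 1).unpair.1

theorem vecFst_le (w : ℕ) : vecFst w ≤ w :=
  (Nat.unpair_left_le _).trans (Nat.sub_le _ _)

theorem vecSnd_le (w : ℕ) : vecSnd w ≤ w :=
  (Nat.unpair_left_le _).trans ((Nat.sub_le _ _).trans
    ((Nat.unpair_right_le _).trans (Nat.sub_le _ _)))

theorem vecFst_vec2 (a b : ℕ) : vecFst (vec2 a b) = a := by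
  simp [vecFst, vec2, pr_nat]

theorem vecSnd_vec2 (a b : ℕ) : vecSnd (vec2 a b) = b := by
  simp [vecSnd, vec2, pr_nat]

/-- The value of the term with the code `t` under the assignment `a`. -/
def evalCode (a t : ℕ) : ℕ :=
  if h : t.unpair.1 = 0 then Nat.beta a t.unpair.2
  else if t.unpair.2.unpair.1 = 0 then 0
  else if t.unpair.2.unpair.1 = 1 then 1
  else
    have := unpair_snd_lt h
    have := Nat.unpair_right_le t.unpair.2
    have := vecFst_le t.unpair.2.unpair.2
    have := vecSnd_le t.unpair.2.unpair.2
    if t.unpair.2.unpair.1 = 2 then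
      evalCode a (vecFst t.unpair.2.unpair.2) + evalCode a (vecSnd t.unpair.2.unpair.2)
    else evalCode a (vecFst t.unpair.2.unpair.2) * evalCode a (vecSnd t.unpair.2.unpair.2)
termination_by t
decreasing_by all_goals omega

/-- The graph of the evaluation of assignments. -/
def stdEnv (a i x : ℕ) : Prop := x = Nat.beta a i

/-- The formula with the code `c` and the free variables `0, …, n - 1` is satisfied by the
assignment `a`. -/
def satCode (c n a : ℕ) : Prop :=
  if h : c.unpair.1 = 0 then False
  else if c.unpair.1 = 1 then evalCode a c.unpair.2.unpair.1 = evalCode a c.unpair.2.unpair.2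
  else if c.unpair.1 = 2 then
    evalCode a (vecFst c.unpair.2.unpair.2) < evalCode a (vecSnd c.unpair.2.unpair.2)
  else
    have := unpair_snd_lt h
    have := Nat.unpair_right_le c.unpair.2
    have := Nat.unpair_left_le c.unpair.2
    if c.unpair.1 = 3 then satCode c.unpair.2.unpair.1 n a → satCode c.unpair.2.unpair.2 n a
    else ∀ x b, Ext stdEnv n a x b → satCode c.unpair.2 (n + 1) b
termination_by c
decreasing_by all_goals omega

section

variable (a n t s c d : ℕ)

theorem evalCode_tmVar (i : ℕ) : evalCode a (tmVar i) = Nat.beta a i := by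
  rw [evalCode]
  simp [tmVar, pr_nat, num_nat]

theorem evalCode_tmZero : evalCode a (tmZero ℕ) = 0 := by
  rw [evalCode]
  simp [tmZero, pr_nat, num_nat]

theorem evalCode_tmOne : evalCode a (tmOne ℕ) = 1 := by
  rw [evalCode]
  simp [tmOne, pr_nat, num_nat]

theorem evalCode_tmAdd : evalCode a (tmAdd t s) = evalCode a t + evalCode a s := by
  rw [evalCode]
  simp [tmAdd, pr_nat, num_nat, vecFst_vec2, vecSnd_vec2]

theorem evalCode_tmMul : evalCode a (tmMul t s) = evalCode a t * evalCode a s := by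
  rw [evalCode]
  simp [tmMul, pr_nat, num_nat, vecFst_vec2, vecSnd_vec2]

variable {t} in
theorem evalCode_of_ne (h : t.unpair.1 ≠ 0) : evalCode a t =
    if t.unpair.2.unpair.1 = 0 then 0
    else if t.unpair.2.unpair.1 = 1 then 1
    else if t.unpair.2.unpair.1 = 2 then
      evalCode a (vecFst t.unpair.2.unpair.2) + evalCode a (vecSnd t.unpair.2.unpair.2)
    else evalCode a (vecFst t.unpair.2.unpair.2) * evalCode a (vecSnd t.unpair.2.unpair.2) := by
  rw [evalCode, dif_neg h]

variable {c} in
theorem satCode_of_ne (h : c.unpair.1 ≠ 0) : satCode c n a =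
    if c.unpair.1 = 1 then evalCode a c.unpair.2.unpair.1 = evalCode a c.unpair.2.unpair.2
    else if c.unpair.1 = 2 then
      evalCode a (vecFst c.unpair.2.unpair.2) < evalCode a (vecSnd c.unpair.2.unpair.2)
    else if c.unpair.1 = 3 then
      satCode c.unpair.2.unpair.1 n a → satCode c.unpair.2.unpair.2 n a
    else ∀ x b, Ext stdEnv n a x b → satCode c.unpair.2 (n + 1) b := by
  rw [satCode, dif_neg h]

theorem satCode_fmBot : ¬ satCode (fmBot ℕ) n a := by
  rw [satCode]
  simp [fmBot, pr_nat, num_nat]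

theorem satCode_fmEq : satCode (fmEq t s) n a ↔ evalCode a t = evalCode a s := by
  rw [satCode]
  simp [fmEq, pr_nat, num_nat]

theorem satCode_fmLt : satCode (fmLt t s) n a ↔ evalCode a t < evalCode a s := by
  rw [satCode]
  simp [fmLt, pr_nat, num_nat, vecFst_vec2, vecSnd_vec2]

theorem satCode_fmImp : satCode (fmImp c d) n a ↔ (satCode c n a → satCode d n a) := by
  rw [satCode]
  simp [fmImp, pr_nat, num_nat]

theorem satCode_fmAll :
    satCode (fmAll c) n a ↔ ∀ x b, Ext stdEnv n a x b → satCode c (n + 1) b := by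
  rw [satCode]
  simp [fmAll, pr_nat, num_nat]

theorem le_pr_left : t ≤ pr t s := pr_nat t s ▸ Nat.left_le_pair t s

theorem le_pr_right : s ≤ pr t s := pr_nat t s ▸ Nat.right_le_pair t s

theorem le_vec2_left : t ≤ vec2 t s := by
  simp only [vec2, pr_nat]
  exact (Nat.left_le_pair _ _).trans (Nat.le_succ _)

theorem le_vec2_right : s ≤ vec2 t s := by
  simp only [vec2, pr_nat]
  exact (Nat.left_le_pair _ _).trans <| (Nat.le_succ _).trans <|
    (Nat.right_le_pair _ _).trans (Nat.le_succ _)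

theorem le_tmAdd : t ≤ tmAdd t s ∧ s ≤ tmAdd t s := by
  have h : vec2 t s ≤ tmAdd t s := (le_pr_right _ _).trans (le_pr_right _ _)
  exact ⟨(le_vec2_left t s).trans h, (le_vec2_right t s).trans h⟩

theorem le_tmMul : t ≤ tmMul t s ∧ s ≤ tmMul t s := by
  have h : vec2 t s ≤ tmMul t s := (le_pr_right _ _).trans (le_pr_right _ _)
  exact ⟨(le_vec2_left t s).trans h, (le_vec2_right t s).trans h⟩

theorem le_fmLt : t ≤ fmLt t s ∧ s ≤ fmLt t s := by
  have h : vec2 t s ≤ fmLt t s := (le_pr_right _ _).trans (le_pr_right _ _)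
  exact ⟨(le_vec2_left t s).trans h, (le_vec2_right t s).trans h⟩

theorem le_fmEq : t ≤ fmEq t s ∧ s ≤ fmEq t s :=
  ⟨(le_pr_left _ _).trans (le_pr_right _ _),
    (le_pr_right _ _).trans (le_pr_right _ _)⟩

theorem le_fmImp : t ≤ fmImp t s ∧ s ≤ fmImp t s :=
  ⟨(le_pr_left _ _).trans (le_pr_right _ _),
    (le_pr_right _ _).trans (le_pr_right _ _)⟩

theorem le_fmAll : c ≤ fmAll c := le_pr_right _ _

end

/-- The standard interpretation of `Val`, for codes with the property `B`. -/
def stdVal (B : ℕ → Prop) (t a x : ℕ) : Prop := B t ∧ x = evalCode a t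

/-- The standard interpretation of `Sat`, for codes with the property `B`. -/
def stdSat (B : ℕ → Prop) (n c a : ℕ) : Prop := B c ∧ satCode c n a

theorem numAxioms_std : NumAxioms fun x y : ℕ => y = numCode x :=
  ⟨rfl, fun _ _ h => h ▸ rfl, fun _ _ _ h h' => h.trans h'.symm⟩

/-- Every number is an assignment through the `β` function. Since only the values below `n` must be
kept, `n + 1` prescribed values suffice. -/
theorem envAxioms_std : EnvAxioms stdEnv := by
  refine ⟨fun n a x => ?_, fun _ _ _ _ h h' => h.trans h'.symm⟩
  obtain ⟨b, hb⟩ := exists_beta (fun i => if i = n then x else Nat.beta a i) (n + 1)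
  refine ⟨b, ?_, fun i hi y => ?_⟩
  · simp [stdEnv, hb n n.lt_succ_self]
  · simp [stdEnv, hb i (hi.trans n.lt_succ_self), hi.ne]

section

variable {P B : ℕ → Prop} (hPB : ∀ c, P c → B c) (hB : ∀ c d, c ≤ d → B d → B c)
include hPB hB

theorem valAxioms_std : ValAxioms P stdEnv (stdVal B) := by
  refine ⟨fun i a x h => ?_, fun a x h => ?_, fun a x h => ?_, fun t s a x h => ?_,
    fun t s a x h => ?_⟩
  · simp [stdVal, hPB _ h, evalCode_tmVar, stdEnv]
  · simp [stdVal, hPB _ h, evalCode_tmZero]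
  · simp [stdVal, hPB _ h, evalCode_tmOne]
  · simp [stdVal, hPB _ h, evalCode_tmAdd, hB _ _ (le_tmAdd t s).1 (hPB _ h),
      hB _ _ (le_tmAdd t s).2 (hPB _ h)]
  · simp [stdVal, hPB _ h, evalCode_tmMul, hB _ _ (le_tmMul t s).1 (hPB _ h),
      hB _ _ (le_tmMul t s).2 (hPB _ h)]

/-- Parts of an expression have codes that are at most its own code. So where the guard puts a code
in the downward closed set `B`, its parts are in `B` too, and the clauses are those of actual
satisfaction. -/
theorem satAxioms_std : SatAxioms P stdEnv (stdVal B) (stdSat B) := by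
  refine ⟨fun n a h => ?_, fun n t s a h => ?_, fun n t s a h => ?_, fun n c d a h => ?_,
    fun n c a h => ?_⟩
  · simp [stdSat, satCode_fmBot]
  · simp [stdVal, stdSat, hPB _ h, satCode_fmEq, hB _ _ (le_fmEq t s).1 (hPB _ h),
      hB _ _ (le_fmEq t s).2 (hPB _ h)]
  · simp [stdVal, stdSat, hPB _ h, satCode_fmLt, hB _ _ (le_fmLt t s).1 (hPB _ h),
      hB _ _ (le_fmLt t s).2 (hPB _ h)]
  · simp [stdSat, hPB _ h, satCode_fmImp, hB _ _ (le_fmImp c d).1 (hPB _ h),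
      hB _ _ (le_fmImp c d).2 (hPB _ h)]
  · simp [stdSat, hPB _ h, satCode_fmAll, hB _ _ (le_fmAll c) (hPB _ h)]

end

theorem indAxiom_nat (E Sat : ℕ → ℕ → ℕ → Prop) : IndAxiom E Sat := fun _ _ _ h₀ h₁ x => by
  induction x with
  | zero => exact h₀
  | succ x ih => exact h₁ x ih

-- Exponentiation and `PA⁻` in the standard model

theorem realize_betaF {n : ℕ} (a b i r : arith.Term (Empty ⊕ Fin n)) (v : Empty → ℕ)
    (xs : Fin n → ℕ) : (betaF a b i r).Realize v xs ↔ r.realize (Sum.elim v xs) =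
      Nat.beta (Nat.pair (a.realize (Sum.elim v xs)) (b.realize (Sum.elim v xs)))
        (i.realize (Sum.elim v xs)) := by
  simp only [betaF, BoundedFormula.realize_inf, realize_ltF, BoundedFormula.realize_ex,
    BoundedFormula.realize_bdEqual, realize_add, realize_mul, realize_one, realize_lift, realize_bv,
    Fin.snoc_last, Nat.beta, Nat.unpair_pair]
  generalize r.realize (Sum.elim v xs) = r
  generalize a.realize (Sum.elim v xs) = a
  generalize b.realize (Sum.elim v xs) = b
  generalize i.realize (Sum.elim v xs) = i
  rw [Nat.add_comm 1]
  constructor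
  · rintro ⟨h, q, rfl⟩
    rw [Nat.mul_comm, Nat.mul_add_mod, Nat.mod_eq_of_lt h]
  · rintro rfl
    exact ⟨Nat.mod_lt _ (Nat.succ_pos _), _, (Nat.div_add_mod' _ _).symm⟩

theorem nat_models_expAxiom : ℕ ⊨ expAxiom := by
  rw [expAxiom, Sentence.Realize, Formula.Realize]
  simp only [BoundedFormula.realize_all, BoundedFormula.realize_ex, expF,
    BoundedFormula.realize_inf, realize_betaF, realize_ballF, realize_bv, realize_add, realize_mul,
    realize_one, realize_zero]
  intro x y
  -- One number codes the powers with exponents `0, …, y`; its two components are the `a` and `b` of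
  -- `expF`.
  obtain ⟨c, hc⟩ := exists_beta (fun i => x ^ i) (y + 1)
  refine ⟨x ^ y, c.unpair.1, c.unpair.2, ?_⟩
  change (1 = Nat.beta (Nat.pair c.unpair.1 c.unpair.2) 0 ∧
    x ^ y = Nat.beta (Nat.pair c.unpair.1 c.unpair.2) y) ∧
    ∀ i < y, ∃ z, z = Nat.beta (Nat.pair c.unpair.1 c.unpair.2) i ∧
      z * x = Nat.beta (Nat.pair c.unpair.1 c.unpair.2) (i + 1)
  simp only [Nat.pair_unpair]
  refine ⟨⟨by simp [hc], (hc y y.lt_succ_self).symm⟩, fun i hi => ⟨_, rfl, ?_⟩⟩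
  rw [hc i (by omega), hc (i + 1) (by omega), pow_succ]

theorem nat_models_PAminus (ψ : arith.Sentence) (h : PAminus ψ) : ℕ ⊨ ψ := by
  cases h <;> simp [Sentence.Realize, Formula.Realize, Fin.snoc]
  case add_assoc => exact Nat.add_assoc
  case add_comm => exact Nat.add_comm
  case mul_assoc => exact Nat.mul_assoc
  case mul_comm => exact Nat.mul_comm
  case mul_add => exact Nat.mul_add
  case lt_trans => exact fun _ _ _ => lt_trans
  case mul_lt => exact fun _ _ _ hc hab => Nat.mul_lt_mul_of_pos_right hab hc
  case lt_sub => exact fun a b h => ⟨b - a, by omega⟩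
  all_goals omega

/-! ## The standard models -/

/-- The standard interpretation of the additional relation symbols, in which `Sat` is truth for the
codes with the property `B`. -/
def stdRel (B : ℕ → Prop) : ∀ k : ℕ, ℕ → (Fin k → ℕ) → Prop
  | 2, 0, v => v 1 = numCode (v 0)
  | 3, 0, v => stdEnv (v 0) (v 1) (v 2)
  | 3, 1, v => stdVal B (v 0) (v 1) (v 2)
  | 3, 2, v => stdSat B (v 0) (v 1) (v 2)
  | _, _, _ => False

/-- The expansion of the standard model by the relations `stdRel B`. -/
@[reducible] def stdStructure (B : ℕ → Prop) : arithPreds.Structure ℕ :=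
  letI : preds.Structure ℕ := ⟨fun f _ => Empty.elim f, fun {k} R v => stdRel B k R v⟩
  Language.sumStructure _ _ ℕ

/-- The standard model with the relations `stdRel B`. -/
def stdModel (B : ℕ → Prop) : Model where
  carrier := ℕ
  str := stdStructure B

/-- Used twice: with `B` everything, for consistency, and with `B` an initial segment `· < k`, for
the model in which truth is not definable. -/
theorem spec_stdModel (G : arith.BoundedFormula (Option (Fin 1)) 0) {B : ℕ → Prop}
    (hB : ∀ c d, c ≤ d → B d → B c) (u : ℕ)
    (hG : ∀ c : ℕ, ¬ G.Realize (fun o : Option (Fin 1) => o.elim c fun _ => fmInst u (numCode u))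
      (default : Fin 0 → ℕ) → B c) :
    Spec G (M := stdModel B) u := by
  have hPB (c : ℕ) (h : Guard G (fun x y : ℕ => y = numCode x) u c) : B c :=
    hG c (by convert h _ rfl)
  exact ⟨nat_models_PAminus, nat_models_expAxiom, numAxioms_std, envAxioms_std,
    valAxioms_std hPB hB, satAxioms_std hPB hB, indAxiom_nat _ _⟩

/-! ## Arithmetical definability -/

/-- A relation on the natural numbers is arithmetical. -/
abbrev Arithmetical {ι : Type} (S : (ι → ℕ) → Prop) : Prop :=
  UDef arith (I := Unit) (M := fun _ => ℕ) fun _ => S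

/-- A function on the natural numbers is arithmetical. -/
abbrev ArithmeticalFun {ι : Type} (f : (ι → ℕ) → ℕ) : Prop :=
  UFun arith (I := Unit) (M := fun _ => ℕ) fun _ => f

section Definability

variable {ι : Type}

theorem arithmeticalFun_beta {f g : (ι → ℕ) → ℕ} (hf : ArithmeticalFun f)
    (hg : ArithmeticalFun g) : ArithmeticalFun fun v => Nat.beta (f v) (g v) := by
  have h : ArithmeticalFun fun v : Fin 2 → ℕ => Nat.beta (v 0) (v 1) := by
    have h' : Arithmetical fun v : Option (Fin 2) → ℕ => ∃ a b q : ℕ, v (some 0) = pr a b ∧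
        a = ((v (some 1) + 1) * b + 1) * q + v none ∧ v none < (v (some 1) + 1) * b + 1 := by
      apply_rules (maxDepth := 200) [UDef.lt (LHom.id arith), UDef.and, UDef.eq, UDef.ex, UFun.var,
        UFun.one (LHom.id arith), UFun.add (LHom.id arith), UFun.mul (LHom.id arith),
        UFun.pr (LHom.id arith)]
    refine ⟨UDef.congr h' fun _ v => ⟨?_, fun h => ?_⟩⟩
    · rintro ⟨a, b, q, h, rfl, hq⟩
      simp only [h, pr_nat, Nat.beta, Nat.unpair_pair, Nat.mul_add_mod, Nat.mod_eq_of_lt hq]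
    · refine ⟨(v (some 0)).unpair.1, (v (some 0)).unpair.2,
        (v (some 0)).unpair.1 / ((v (some 1) + 1) * (v (some 0)).unpair.2 + 1),
        by rw [pr_nat, Nat.pair_unpair], ?_, ?_⟩
      · rw [h, Nat.beta, Nat.div_add_mod]
      · rw [h]
        exact Nat.mod_lt _ (Nat.succ_pos _)
  exact h.comp (f := ![fun _ => f, fun _ => g]) (by simp [Fin.forall_fin_two, hf, hg])

theorem arithmeticalFun_numCode {f : (ι → ℕ) → ℕ} (hf : ArithmeticalFun f) :
    ArithmeticalFun fun v => numCode (f v) := by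
  have h : ArithmeticalFun fun v : Fin 1 → ℕ => numCode (v 0) := by
    -- The primitive recursion is replaced by a `β`-coded sequence of its values.
    have h' : Arithmetical fun v : Option (Fin 1) → ℕ => ∃ b : ℕ, Nat.beta b 0 = tmZero ℕ ∧
        (∀ i, i < v (some 0) → Nat.beta b (i + 1) = tmAdd (Nat.beta b i) (tmOne ℕ)) ∧
        v none = Nat.beta b (v (some 0)) := by
      unfold tmZero tmAdd tmOne vec2
      apply_rules (maxDepth := 200) [UDef.lt (LHom.id arith), UDef.and, UDef.imp, UDef.eq, UDef.ex,
        UDef.all, UFun.var, arithmeticalFun_beta, UFun.zero (LHom.id arith),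
        UFun.one (LHom.id arith), UFun.num (LHom.id arith), UFun.add (LHom.id arith),
        UFun.mul (LHom.id arith), UFun.pr (LHom.id arith)]
    refine ⟨UDef.congr h' fun _ v => ⟨?_, fun h => ?_⟩⟩
    · rintro ⟨b, h₀, h₁, h⟩
      have key (i : ℕ) (hi : i ≤ v (some 0)) : Nat.beta b i = numCode i := by
        induction i with
        | zero => exact h₀
        | succ i ih => rw [h₁ i hi, ih (Nat.le_of_succ_le hi)]; rfl
      rw [h, key _ le_rfl]
    · obtain ⟨b, hb⟩ := exists_beta numCode (v (some 0) + 1)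
      refine ⟨b, hb 0 (Nat.succ_pos _), fun i hi => ?_, ?_⟩
      · rw [hb i (by omega), hb (i + 1) (by omega)]; rfl
      · rw [h, hb _ (Nat.lt_succ_self _)]
  exact h.comp (f := fun _ _ => f) fun _ => hf

/-- The code `t` is fixed, so the recursion is unfolded outside the formula, which depends on `t`.
-/
theorem arithmeticalFun_evalCode {f : (ι → ℕ) → ℕ} (hf : ArithmeticalFun f) (t : ℕ) :
    ArithmeticalFun fun v => evalCode (f v) t := by
  induction t using Nat.strong_induction_on with
  | _ t ih =>
    by_cases h : t.unpair.1 = 0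
    · have : (fun v => evalCode (f v) t) = fun v => Nat.beta (f v) (num ℕ t.unpair.2) := by
        ext v
        rw [evalCode, dif_pos h, num_nat]
      rw [this]
      exact arithmeticalFun_beta hf (UFun.num (LHom.id arith) _)
    have h₀ := unpair_snd_lt h
    have h₁ := Nat.unpair_right_le t.unpair.2
    have h₂ := vecFst_le t.unpair.2.unpair.2
    have h₃ := vecSnd_le t.unpair.2.unpair.2
    have i₁ := ih (vecFst t.unpair.2.unpair.2) (by omega)
    have i₂ := ih (vecSnd t.unpair.2.unpair.2) (by omega)
    simp only [evalCode_of_ne _ h]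
    split_ifs
    · exact UFun.zero (LHom.id arith)
    · exact UFun.one (LHom.id arith)
    · exact UFun.add (LHom.id arith) i₁ i₂
    · exact UFun.mul (LHom.id arith) i₁ i₂

/-- Satisfaction is arithmetical for each single code `c`, though not uniformly in `c`: the
quantifiers are unfolded along the recursion. The variable type is generalized because each
quantifier adds variables. -/
theorem arithmetical_satCode (c : ℕ) {f g : (ι → ℕ) → ℕ} (hf : ArithmeticalFun f)
    (hg : ArithmeticalFun g) : Arithmetical fun v => satCode c (f v) (g v) := by
  induction c using Nat.strong_induction_on generalizing ι with
  | _ c ih =>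
    by_cases h : c.unpair.1 = 0
    · exact UDef.false.congr fun _ v => by rw [satCode, dif_pos h]
    have h₀ := unpair_snd_lt h
    have h₁ := Nat.unpair_right_le c.unpair.2
    have h₂ := Nat.unpair_left_le c.unpair.2
    simp only [satCode_of_ne _ _ h]
    split_ifs
    · exact UDef.eq (arithmeticalFun_evalCode hg _) (arithmeticalFun_evalCode hg _)
    · exact UDef.lt (LHom.id arith) (arithmeticalFun_evalCode hg _) (arithmeticalFun_evalCode hg _)
    · exact UDef.imp (ih _ (by omega) hf hg) (ih _ (by omega) hf hg)
    · have h : Arithmetical fun v : Fin 2 → ℕ =>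
          ∀ x b, Ext stdEnv (v 0) (v 1) x b → satCode c.unpair.2 (v 0 + 1) b := by
        have ih' {ι : Type} {f g : (ι → ℕ) → ℕ} (hf : ArithmeticalFun f)
          (hg : ArithmeticalFun g) := ih _ h₀ hf hg
        unfold Ext stdEnv
        apply_rules (maxDepth := 200) [ih', UDef.lt (LHom.id arith), UDef.and, UDef.iff, UDef.imp,
          UDef.eq, UDef.all, UFun.var, arithmeticalFun_beta, UFun.one (LHom.id arith),
          UFun.add (LHom.id arith)]
      exact h.comp (f := ![fun _ => f, fun _ => g]) (by simp [Fin.forall_fin_two, hf, hg])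

/-- A disjunction over the finitely many values below `k` needs no uniformity of `S` in its first
argument. This is why satisfaction cut off at `k` is arithmetical. -/
theorem arithmetical_lt_and {k : ℕ} {S : ℕ → (ι → ℕ) → Prop} (hS : ∀ c, Arithmetical (S c))
    {f : (ι → ℕ) → ℕ} (hf : ArithmeticalFun f) : Arithmetical fun v => f v < k ∧ S (f v) v := by
  have h : Arithmetical fun v => ¬ ∀ j : Fin k, ¬ (f v = num ℕ j ∧ S j v) :=
    .not (.all_finite fun j => .not (.and (.eq hf (.num (LHom.id arith) _)) (hS _)))
  refine h.congr fun _ v => ?_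
  push Not
  refine ⟨fun ⟨j, hj, h⟩ => ?_, fun ⟨hj, h⟩ => ⟨⟨f v, hj⟩, (num_nat _).symm, h⟩⟩
  rw [num_nat] at hj
  rw [hj]
  exact ⟨j.2, h⟩

theorem arithmetical_stdRel (m : ℕ) : ∀ k i : ℕ, Arithmetical (stdRel (· < m) k i)
  | 2, 0 => UDef.eq (.var _) (arithmeticalFun_numCode (.var _))
  | 3, 0 => UDef.eq (.var _) (arithmeticalFun_beta (.var _) (.var _))
  | 3, 1 => arithmetical_lt_and (S := fun c v => v 2 = evalCode (v 1) c)
      (fun _ => UDef.eq (.var _) (arithmeticalFun_evalCode (.var _) _)) (.var _)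
  | 3, 2 => arithmetical_lt_and (S := fun c v => satCode c (v 0) (v 2))
      (fun c => arithmetical_satCode c (.var _) (.var _)) (.var _)
  | 0, _ | 1, _ | 2, _ + 1 | 3, _ + 3 | _ + 4, _ => UDef.false

/-- The new symbols can be eliminated, since their interpretations are arithmetical. -/
theorem arithmetical_realize (m : ℕ) {α : Type} {n : ℕ} (φ : arithPreds.BoundedFormula α n) :
    Arithmetical fun w : α ⊕ Fin n → ℕ =>
      letI := stdStructure (· < m)
      φ.Realize (fun a => w (.inl a)) fun i => w (.inr i) := by
  let _ := stdStructure (· < m)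
  have hterm {β : Type} (t : arithPreds.Term β) :
      ArithmeticalFun fun w : β → ℕ => t.realize w := by
    induction t with
    | var b => exact .var b
    | func f ts ih =>
      cases f with
      | inl f => exact UFun.func (L := arith) f (f := fun j _ w => (ts j).realize w) ih
      | inr f => exact f.elim
  have hterm' {n : ℕ} (t : arithPreds.Term (α ⊕ Fin n)) : ArithmeticalFun fun w : α ⊕ Fin n → ℕ =>
      t.realize (Sum.elim (fun a => w (.inl a)) fun i => w (.inr i)) := by
    convert hterm t with w
    ext (a | i) <;> rfl
  induction φ with
  | falsum => exact UDef.false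
  | equal t s => exact UDef.eq (hterm' t) (hterm' s)
  | rel R ts =>
    cases R with
    | inl R => exact UDef.rel (L := arith) R (f := fun j _ w =>
        (ts j).realize (Sum.elim (fun a => w (Sum.inl a)) fun i => w (Sum.inr i))) fun j => hterm' _
    | inr R => exact (arithmetical_stdRel m _ R).comp (f := fun j _ w =>
        (ts j).realize (Sum.elim (fun a => w (Sum.inl a)) fun i => w (Sum.inr i))) fun j => hterm' _
  | imp φ ψ ih₁ ih₂ => exact UDef.imp ih₁ ih₂
  | @all n φ ih =>
    refine UDef.all (I := Unit) (S := fun _ w x => φ.Realize (fun a => w (Sum.inl a))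
      (Fin.snoc (fun i => w (Sum.inr i)) x : Fin (n + 1) → ℕ)) ?_
    refine (ih.reindex (ι := Option (α ⊕ Fin n)) (Sum.elim (fun a => some (.inl a))
      (Fin.snoc (fun i => some (.inr i)) none : Fin (n + 1) → Option (α ⊕ Fin n)))).congr
      fun _ w => ?_
    dsimp only [Sum.elim_inl, Sum.elim_inr]
    congr! with i
    refine Fin.lastCases ?_ (fun i => ?_) i <;> simp

end Definability

/-! ## Undefinability of truth -/

/-- Tarski's theorem. The formula `ψ(x)` says that the instance of the formula with code `x` at the
numeral of `x` is not in `T`; `σ` is the instance of `ψ` at its own code, and so asserts that its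
own code is not in `T`. -/
theorem not_arithmetical_truth {T : ℕ → Prop} (hT : Arithmetical fun v : Fin 1 → ℕ => T (v 0)) :
    ¬ ∀ σ : arith.Sentence, T (code (incl.onSentence σ)) ↔ ℕ ⊨ σ := by
  intro h
  have hD : Arithmetical fun v : Fin 1 → ℕ => ¬ T (fmInst (v 0) (numCode (v 0))) := by
    refine UDef.not (hT.comp (f := fun _ _ v => fmInst (v 0) (numCode (v 0))) fun _ => ?_)
    unfold fmInst fmAll fmImp fmEq tmVar
    apply_rules (maxDepth := 200) [UFun.var, arithmeticalFun_numCode, UFun.num (LHom.id arith),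
      UFun.pr (LHom.id arith)]
  obtain ⟨φ, hφ⟩ := hD
  let ψ : arith.BoundedFormula Empty 1 := BoundedFormula.relabel (k := 0) Sum.inr φ
  let n := code (incl.onBoundedFormula ψ)
  let σ : arith.Sentence := ∀' ((Term.var (Sum.inr 0)).bdEqual (numeral n) ⟹ ψ)
  have hσ : incl.onSentence σ = inst (incl.onBoundedFormula ψ) n := rfl
  have hσ' : ℕ ⊨ σ ↔ ¬ T (fmInst n (numCode n)) := by
    have (v : Empty → ℕ) (xs : Fin 1 → ℕ) : ψ.Realize v xs ↔
        ¬ T (fmInst (xs 0) (numCode (xs 0))) :=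
      (Formula.realize_relabel_sumInr φ).trans (hφ () _)
    simp only [σ, Sentence.Realize, Formula.Realize, BoundedFormula.realize_all,
      BoundedFormula.realize_imp, BoundedFormula.realize_bdEqual, realize_numeral, num_nat, this]
    exact forall_eq
  have := h σ
  rw [hσ, code_inst, hσ'] at this
  exact iff_not_self this

/-! ## Injectivity of the coding -/

theorem codeVec_injective {k : ℕ} : Function.Injective (codeVec (k := k)) :=
  Encodable.encode_injective.comp List.ofFn_injective

theorem codeTerm_injective {n : ℕ} (t s : arithPreds.Term (Empty ⊕ Fin n))
    (h : codeTerm t = codeTerm s) : t = s := by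
  induction t generalizing s with
  | var i =>
    obtain i | i := i
    · exact i.elim
    cases s with
    | var j =>
      obtain j | j := j
      · exact j.elim
      · simp only [codeTerm, Nat.pair_eq_pair, true_and] at h
        rw [Fin.ext h]
    | func g us => simp [codeTerm] at h
  | @func k f ts ih =>
    cases s with
    | var j =>
      obtain j | j := j
      · exact j.elim
      · simp [codeTerm] at h
    | @func l g us =>
      simp only [codeTerm, Nat.pair_eq_pair, true_and] at h
      obtain ⟨hf, hv⟩ := h
      obtain f | f := f
      swap
      · exact f.elim
      obtain g | g := g
      swap
      · exact g.elim
      have : (⟨k, f⟩ : Σ k, ArithFunc k) = ⟨l, g⟩ := by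
        cases f <;> cases g <;> first | rfl | simp [codeFunc] at hf
      cases this
      congr 1
      funext i
      exact ih i _ (congrFun (codeVec_injective hv) i)

/-- Needed to pass from membership of the code of `α` in `DEF` to `α` itself being a definition of
truth. -/
theorem code_injective {n : ℕ} (φ ψ : arithPreds.BoundedFormula Empty n)
    (h : code φ = code ψ) : φ = ψ := by
  induction φ with
  | falsum => cases ψ <;> simp [code] at h ⊢
  | equal t s =>
    cases ψ with
    | equal t' s' =>
      simp only [code, Nat.pair_eq_pair, true_and] at h
      rw [codeTerm_injective _ _ h.1, codeTerm_injective _ _ h.2]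
    | _ => simp [code] at h
  | @rel n k R ts =>
    cases ψ with
    | @rel _ l S us =>
      simp only [code, Nat.pair_eq_pair, true_and] at h
      obtain ⟨hR, hv⟩ := h
      have : (⟨k, R⟩ : Σ k, arithPreds.Relations k) = ⟨l, S⟩ := by
        obtain R | R := R <;> obtain S | S := S
        · cases R
          cases S
          rfl
        · cases R
          simp [codeRel] at hR
        · cases S
          simp [codeRel] at hR
        · obtain ⟨rfl, hRS⟩ := Nat.pair_eq_pair.1 (Nat.add_right_cancel hR)
          obtain rfl : R = S := hRS
          rfl
      cases this
      congr 1
      funext i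
      exact codeTerm_injective _ _ (congrFun (codeVec_injective hv) i)
    | _ => simp [code] at h
  | imp φ₁ φ₂ ih₁ ih₂ =>
    cases ψ with
    | imp ψ₁ ψ₂ =>
      simp only [code, Nat.pair_eq_pair, true_and] at h
      rw [ih₁ _ h.1, ih₂ _ h.2]
    | _ => simp [code] at h
  | all φ ih =>
    cases ψ with
    | all ψ =>
      simp only [code, Nat.pair_eq_pair, true_and] at h
      rw [ih _ h]
    | _ => simp [code] at h

/-! ## Guarded definitions of truth -/

section

variable {G : arith.BoundedFormula (Option (Fin 1)) 0} (A : Model)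

/-- The axioms for `Num` fix the code of each standard numeral, so at the standard `u` the guard
speaks about the true code of the instance. -/
theorem guard_num (hM : IsEndExtension A) (hN : NumAxioms (M := A) (rel2 0)) {u : ℕ}
    (hG : ∀ c : ℕ, ¬ G.Realize (fun a => num A (a.elim c fun _ => fmInst u (numCode u)))
      (fun i => num A ((default : Fin 0 → ℕ) i))) (c : ℕ) :
    Guard G (rel2 0) (num A u) (num A c) := by
  have key (x : ℕ) : rel2 0 (num A x) (num A (numCode x)) := by
    induction x with
    | zero =>
      rw [numCode, hM.num_tmZero]
      exact hN.1
    | succ x ih =>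
      rw [numCode, hM.num_tmAdd, hM.num_tmOne]
      exact hN.2.1 _ _ ih
  intro y hy h
  rw [hN.2.2 _ _ _ hy (key u), ← hM.num_fmInst] at h
  refine hG c ?_
  convert h with o
  cases o <;> rfl

theorem realize_subst_numeral (Θ : arithPreds.Formula (Fin 1)) (n : ℕ) (v : Empty → A) :
    Formula.Realize (Θ.subst fun _ => incl.onTerm (numeral n)) v ↔
      Θ.Realize fun _ => num A n := by
  rw [Formula.Realize, BoundedFormula.realize_subst]
  simp only [LHom.realize_onTerm, realize_numeral]
  rfl

theorem realize_tarskiBiconditional (Θ : arithPreds.Formula (Fin 1)) (σ : arith.Sentence) :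
    A ⊨ tarskiBiconditional Θ σ ↔
      ((Θ.Realize fun _ => num A (code (incl.onSentence σ))) ↔ A ⊨ σ) := by
  rw [tarskiBiconditional, Sentence.Realize, Formula.realize_iff, realize_subst_numeral]
  exact iff_congr Iff.rfl (LHom.realize_onSentence A incl σ)

theorem realize_inst {φ : arithPreds.BoundedFormula Empty 1} (n : ℕ) :
    A ⊨ inst φ n ↔ φ.Realize default fun _ => num A n := by
  have h (x : A) (v : Fin 0 → A) : (Fin.snoc v x : Fin 1 → A) = fun _ => x := by
    ext i
    exact Fin.lastCases (Fin.snoc_last _ _) (fun i => i.elim0) i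
  simp only [inst, Sentence.Realize, Formula.Realize, BoundedFormula.realize_all,
    BoundedFormula.realize_imp, BoundedFormula.realize_bdEqual, LHom.realize_onTerm,
    realize_numeral, Term.realize_var, Sum.elim_inr]
  constructor
  · intro H
    rw [← h _ default]
    exact H _ (congrFun (h _ _) 0)
  · intro H x hx
    obtain rfl : x = num A n := (congrFun (h _ _) 0).symm.trans hx
    rwa [h]

end

/-- The sentence `α` axiomatizes `Spec` for its own code. -/
theorem exists_spec_sentence (G : arith.BoundedFormula (Option (Fin 1)) 0) :
    ∃ (α : arithPreds.Sentence) (u : ℕ), code α = fmInst u (numCode u) ∧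
      ∀ A : Model, A ⊨ α ↔ Spec G (num A u) := by
  obtain ⟨ψ, hψ⟩ := uDef_spec G
  refine ⟨inst (BoundedFormula.relabel (k := 0) Sum.inr ψ) _, _, code_inst _ _, fun A => ?_⟩
  rw [realize_inst]
  exact (Formula.realize_relabel_sumInr ψ).trans (hψ A _)

theorem isTruthDefinition_of_spec {G : arith.BoundedFormula (Option (Fin 1)) 0}
    {α : arithPreds.Sentence} {u : ℕ} (hα : ∀ A : Model, A ⊨ α ↔ Spec G (num A u))
    (hG : ∀ (A : Model), IsEndExtension A → ∀ c : ℕ,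
      ¬ G.Realize (fun a => num A (a.elim c fun _ => fmInst u (numCode u)))
        (fun i => num A ((default : Fin 0 → ℕ) i))) :
    IsTruthDefinition α := by
  have hstd : Spec G (M := stdModel fun _ => True) u :=
    spec_stdModel G (fun _ _ _ h => h) u fun _ _ => trivial
  rw [← num_nat u] at hstd
  have hguard (A : Model) (hA : A ⊨ α) (c : ℕ) : Guard G (rel2 0) (num A u) (num A c) := by
    obtain ⟨h, -, hN, -⟩ := (hα A).1 hA
    have hM := isEndExtension_of_PAminus h
    exact guard_num A hM hN (hG A hM) c
  refine ⟨?_, fun ψ hψ => ?_, ?_⟩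
  · have : (stdModel fun _ => True) ⊨ ({α} : arithPreds.Theory) :=
      Theory.model_singleton_iff.2 ((hα _).2 hstd)
    have : Nonempty (stdModel fun _ => True) := ⟨(0 : ℕ)⟩
    exact Theory.Model.isSatisfiable (stdModel fun _ => True)
  · have hEA (A : Model) (hA : A ⊨ α) : A ⊨ ψ := by
      obtain ⟨h, hexp, -, hE, hV, hS, hI⟩ := (hα A).1 hA
      obtain (hψ | ⟨n, φ, -, rfl⟩) | rfl := hψ
      · exact h ψ hψ
      · exact realize_inductionAxiom (isEndExtension_of_PAminus h) (hguard A hA) hE hV hS hI φ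
      · exact hexp
    refine Theory.models_sentence_iff.2 fun M => ?_
    exact (LHom.realize_onSentence _ incl ψ).2
      (hEA (Model.mk M) (Theory.model_singleton_iff.1 M.is_model))
  -- Truth is satisfaction by some assignment, with no free variables. Every assignment represents
  -- the empty tuple, so the choice of assignment is irrelevant for sentences.
  · obtain ⟨Θ, hΘ⟩ : UDef arithPreds Model.carrier fun A (v : Fin 1 → A) =>
        ∃ a, rel3 2 (num A 0) (v 0) a :=
      .ex (.rel3 _ (.num incl _) (.var _) (.var _))
    have hT (A : Model) (hA : A ⊨ α) (σ : arith.Sentence) : A ⊨ tarskiBiconditional Θ σ := by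
      obtain ⟨h, -, -, hE, hV, hS, -⟩ := (hα A).1 hA
      have hsat (a : A) := sat_iff (isEndExtension_of_PAminus h) (hguard A hA) hE hV hS σ (a := a)
        (v := default) fun i => i.elim0
      refine (realize_tarskiBiconditional A Θ σ).2 ((hΘ _ _).trans ?_)
      exact ⟨fun ⟨a, ha⟩ => (hsat a).1 ha, fun h => ⟨0, (hsat 0).2 h⟩⟩
    refine ⟨Θ, fun σ => Theory.models_sentence_iff.2 fun M => ?_⟩
    exact hT (Model.mk M) (Theory.model_singleton_iff.1 M.is_model) σ

/-- In this model a truth formula `Θ` would define the truth of arithmetical sentences in `ℕ`, but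
everything definable in it is arithmetical. -/
theorem not_isTruthDefinition_of_stdModel {α : arithPreds.Sentence} {k : ℕ}
    (hα : stdModel (· < k) ⊨ α) : ¬ IsTruthDefinition α := by
  rintro ⟨-, -, Θ, hΘ⟩
  have : stdModel (· < k) ⊨ ({α} : arithPreds.Theory) := Theory.model_singleton_iff.2 hα
  have : Nonempty (stdModel (· < k)) := ⟨(0 : ℕ)⟩
  let T (x : ℕ) : Prop := Θ.Realize (M := stdModel (· < k)) fun _ => x
  have hT : Arithmetical fun v : Fin 1 → ℕ => T (v 0) := by
    refine ((arithmetical_realize k Θ).reindex (Sum.elim id Fin.elim0)).congr fun _ v => ?_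
    have hv : (fun _ : Fin 1 => v 0) = v := funext fun i => congrArg v (Subsingleton.elim _ _)
    simp only [T, hv]
    refine iff_of_eq (congrArg (BoundedFormula.Realize (M := stdModel (· < k)) Θ v) ?_)
    exact funext fun i => i.elim0
  refine not_arithmetical_truth hT fun σ => ?_
  have h := (realize_tarskiBiconditional _ Θ σ).1 ((hΘ σ).realize_sentence (stdModel (· < k)))
  have e : num (stdModel (· < k)) (code (incl.onSentence σ)) = code (incl.onSentence σ) :=
    num_nat _
  rw [e] at h
  exact h

end TruthDef

-- The diagonal argument

theorem mainTheorem3 : ¬ TruthDef.SigmaDefinable 2 TruthDef.DEF := by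
  open TruthDef in
  rintro ⟨φ, hφ, hDEF⟩
  obtain ⟨G, h₁, h₂, h₃⟩ := hφ.exists_bounded
  obtain ⟨α, u, hcode, hα⟩ := exists_spec_sentence G
  have hmem := hDEF (code α)
  rw [Formula.Realize, h₁] at hmem
  by_cases h : code α ∈ DEF
  · obtain ⟨k, hk⟩ := hmem.2 h
    obtain ⟨β, hβ, hβα⟩ := h
    obtain rfl := code_injective _ _ hβα
    refine not_isTruthDefinition_of_stdModel (k := k) ((hα _).2 ?_) hβ
    have hstd : Spec G (M := stdModel (· < k)) u := by
      refine spec_stdModel G (fun _ _ => lt_of_le_of_lt) u fun c hc => ?_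
      -- A code `c ≥ k` fails the guard: `G` holds at `k`, hence at `c` by monotonicity.
      by_contra hck
      refine hc ?_
      rw [← hcode]
      convert h₂ _ _ _ _ (not_lt.1 hck) hk
    rw [← num_nat u] at hstd
    exact hstd
  -- If `G` held at a standard `c` in some end-extension, it would hold in `ℕ`, and so the code of
  -- `α` would be in `DEF` after all.
  · refine h ⟨α, isTruthDefinition_of_spec hα fun A hA c hc => h (hmem.1 ⟨c, ?_⟩), rfl⟩
    rw [hcode]
    convert h₃ A hA (fun o => o.elim c fun _ => fmInst u (numCode u)) default hc
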